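/- Let $\mathbb F$ be a field with $\operatorname{char}\mathbb F\neq 2,7$. Let $Vir_{\mathbb F}$ be the Lie algebra with basis $L_n$ $(n\in\mathbb Z)$, $C$ and relations $[L_m,L_n]=(m-n)L_{m+n}+\frac{m^3-m}{12}\delta_{m+n,0}C$, $[Vir_{\mathbb F},C]=0$ (here $\frac{m^3-m}{12}$ is the image in $\mathbb F$ of an element of $\mathbb Z[\frac12]$). For $c,h\in\mathbb F$ let $V(c,h)_{\mathbb F}$ be the Verma module, generated by $v_{c,h}$ with $L_nv_{c,h}=0$ for $n>0$, $L_0v_{c,h}=hv_{c,h}$, $Cv_{c,h}=cv_{c,h}$; it is graded by $V(c,h)_{\mathbb F}(n)=\operatorname{span}\{L_{-n_1}\cdots L_{-n_k}v_{c,h} : n_i\ge 1,\ \sum n_i=n\}$, $n\ge 0$. Let $L(c,h)_{\mathbb F}=V(c,h)_{\mathbb F}/W(c,h)_{\mathbb F}$, where $W(c,h)_{\mathbb F}$ is the maximal proper graded submodule. For $Z=\mathbb Z+\frac12$ or $Z=\mathbb Z$ let $A(H_{\mathbb F},Z)$ be the associative $\mathbb F$-algebra generated by $a(n)$, $n\in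 Z$, with relations $a(m)a(n)+a(n)a(m)=\delta_{m+n,0}$, and let $V(H_{\mathbb F},Z)=A(H_{\mathbb F},Z)\big/\sum_{n>0}A(H_{\mathbb F},Z)a(n)$, with $\mathbf 1$ the image of $1$. For $s=0,1$ let $V(H_{\mathbb F},Z)_{\bar s}$ be the span of the monomials $a(n_1)\cdots a(n_k)\mathbf 1$ with $k\equiv s$ mod $2$. Set $:a(m)a(n):\;=a(m)a(n)$ if $m\le n$ and $-a(n)a(m)$ if $m>n$, and let $$L(n)=\tfrac12\sum_{j\in Z}j:a(-j)a(n+j):\;+\;\epsilon_n,$$ where $\epsilon_n=\frac1{16}$ if $Z=\mathbb Z$ and $n=0$, and $\epsilon_n=0$ otherwise. Then $L_n\mapsto L(n)$, $C\mapsto\frac12$ makes each $V(H_{\mathbb F},Z)_{\bar s}$ a $Vir_{\mathbb F}$-module, and as $Vir_{\mathbb F}$-modules $$V(H_{\mathbb F},\mathbb Z+\tfrac12)_{\bar 0}\cong L(\tfrac12,0)_{\mathbb F},\qquad V(H_{\mathbb F},\mathbb Z+\tfrac12)_{\bar 1}\cong L(\tfrac12,\tfrac12)_{\mathbb F},\qquad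 V(H_{\mathbb F},\mathbb Z)_{\bar s}\cong L(\tfrac12,\tfrac1{16})_{\mathbb F}\quad(s=0,1).$$ -/

import Mathlib

noncomputable section

/-! ### The Virasoro algebra -/

/-- The Virasoro algebra over `F`: the space with basis `L n` (`n : ℤ`) and `C`. -/
def Vir (F : Type*) [Field F] : Type _ := (ℤ →₀ F) × F

namespace Vir

variable (F : Type*) [Field F]

instance : AddCommGroup (Vir F) := inferInstanceAs (AddCommGroup ((ℤ →₀ F) × F))

instance : Module F (Vir F) := inferInstanceAs (Module F ((ℤ →₀ F) × F))

/-- The identification of the Virasoro algebra with its underlying space of coordinates. -/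
def coords : Vir F ≃ₗ[F] (ℤ →₀ F) × F := LinearEquiv.refl F ((ℤ →₀ F) × F)

/-- The basis element `L_n`. -/
def L (n : ℤ) : Vir F := (coords F).symm (Finsupp.single n 1, 0)

/-- The central basis element `C`. -/
def C : Vir F := (coords F).symm (0, 1)

/-- The number `(m ^ 3 - m) / 12`, as an element of `F`. The integer `m ^ 3 - m` is divisible by
`6`, so this makes sense whenever `2` is invertible, also in characteristic `3`. -/
def central (m : ℤ) : F := (((m ^ 3 - m) / 6 : ℤ) : F) / 2

/-- The bilinear map with `(L_m, L_n) ↦ (m - n) L_{m+n}`. -/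
def wittBracket : (ℤ →₀ F) →ₗ[F] (ℤ →₀ F) →ₗ[F] (ℤ →₀ F) :=
  Finsupp.linearCombination F fun m : ℤ =>
    Finsupp.linearCombination F fun n : ℤ => Finsupp.single (m + n) ((m - n : ℤ) : F)

/-- The bilinear form with `(L_m, L_n) ↦ δ_{m+n,0} (m ^ 3 - m) / 12`. -/
def cocycle : (ℤ →₀ F) →ₗ[F] (ℤ →₀ F) →ₗ[F] F :=
  Finsupp.linearCombination F fun m : ℤ =>
    Finsupp.linearCombination F fun n : ℤ => if m + n = 0 then central F m else 0

theorem wittBracket_single (m n : ℤ) (a b : F) :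
    wittBracket F (Finsupp.single m a) (Finsupp.single n b) =
      Finsupp.single (m + n) (a * b * ((m - n : ℤ) : F)) := by
  simp only [wittBracket, Finsupp.linearCombination_single, LinearMap.smul_apply,
    Finsupp.smul_single, smul_eq_mul, mul_assoc]

theorem cocycle_single (m n : ℤ) (a b : F) :
    cocycle F (Finsupp.single m a) (Finsupp.single n b) =
      if m + n = 0 then a * b * central F m else 0 := by
  simp [cocycle, Finsupp.linearCombination_single, mul_assoc]

theorem six_dvd (m : ℤ) : (6 : ℤ) ∣ m ^ 3 - m := by
  have h : m % 6 = 0 ∨ m % 6 = 1 ∨ m % 6 = 2 ∨ m % 6 = 3 ∨ m % 6 = 4 ∨ m % 6 = 5 := by omega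
  apply Int.dvd_of_emod_eq_zero
  rcases h with h | h | h | h | h | h <;> simp [Int.sub_emod, pow_succ, Int.mul_emod, h]

theorem central_neg (m : ℤ) : central F (-m) = - central F m := by
  have h : ((-m) ^ 3 - (-m)) / 6 = -((m ^ 3 - m) / 6) := by
    obtain ⟨k, hk⟩ := six_dvd m
    rw [hk, show (-m) ^ 3 - (-m) = 6 * (-k) by linear_combination -hk,
      Int.mul_ediv_cancel_left _ (by norm_num), Int.mul_ediv_cancel_left _ (by norm_num)]
  rw [central, h, Int.cast_neg, neg_div, central]

theorem central_jacobi (l m n : ℤ) (h : l + m + n = 0) :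
    ((m - n : ℤ) : F) * central F l + ((n - l : ℤ) : F) * central F m +
      ((l - m : ℤ) : F) * central F n = 0 := by
  obtain ⟨a, ha⟩ := six_dvd l
  obtain ⟨b, hb⟩ := six_dvd m
  obtain ⟨c, hc⟩ := six_dvd n
  have key : (m - n) * a + (n - l) * b + (l - m) * c = 0 := by
    have : 6 * ((m - n) * a + (n - l) * b + (l - m) * c) = 0 := by
      obtain rfl : n = -l - m := by omega
      linear_combination -(2 * m + l) * ha + (2 * l + m) * hb - (l - m) * hc
    omega
  have key' := congrArg (Int.cast : ℤ → F) key
  simp only [central, ha, hb, hc]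
  push_cast at key' ⊢
  simp only [Int.mul_ediv_cancel_left _ (show (6 : ℤ) ≠ 0 by norm_num)]
  linear_combination key' / 2

theorem wittBracket_self (x : ℤ →₀ F) : wittBracket F x x = 0 := by
  have skew : ∀ x y, wittBracket F x y = - wittBracket F y x := by
    intro x y
    induction x using Finsupp.induction_linear with
    | zero => simp
    | add x x' hx hx' => simp [hx, hx', add_comm]
    | single m a =>
      induction y using Finsupp.induction_linear with
      | zero => simp
      | add y y' hy hy' => simp [hy, hy', add_comm]
      | single n b =>
        rw [wittBracket_single, wittBracket_single, add_comm n m, ← Finsupp.single_neg]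
        congr 1
        push_cast
        ring
  induction x using Finsupp.induction_linear with
  | zero => simp
  | add x y hx hy => simp [hx, hy, skew x y]
  | single m a => simp [wittBracket_single]

theorem cocycle_skew (x y : ℤ →₀ F) : cocycle F x y = - cocycle F y x := by
  induction x using Finsupp.induction_linear with
  | zero => simp
  | add x x' hx hx' => simp [hx, hx', add_comm]
  | single m a =>
    induction y using Finsupp.induction_linear with
    | zero => simp
    | add y y' hy hy' => simp [hy, hy', add_comm]
    | single n b =>
      rw [cocycle_single, cocycle_single, add_comm n m]
      split_ifs with h
      · obtain rfl : n = -m := by omega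
        rw [central_neg]
        ring
      · simp

theorem cocycle_self (x : ℤ →₀ F) : cocycle F x x = 0 := by
  induction x using Finsupp.induction_linear with
  | zero => simp
  | add x y hx hy => simp [hx, hy, cocycle_skew F x y]
  | single m a =>
    rw [cocycle_single]
    split_ifs with h
    · obtain rfl : m = 0 := by omega
      simp [central]
    · rfl

theorem wittBracket_leibniz (x y z : ℤ →₀ F) :
    wittBracket F x (wittBracket F y z) =
      wittBracket F (wittBracket F x y) z + wittBracket F y (wittBracket F x z) := by
  induction x using Finsupp.induction_linear with
  | zero => simp
  | add x x' hx hx' => simp only [map_add, LinearMap.add_apply, hx, hx']; abel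
  | single l a =>
    induction y using Finsupp.induction_linear with
    | zero => simp
    | add y y' hy hy' => simp only [map_add, LinearMap.add_apply, hy, hy']; abel
    | single m b =>
      induction z using Finsupp.induction_linear with
      | zero => simp
      | add z z' hz hz' => simp only [map_add, hz, hz']; abel
      | single n c =>
        simp only [wittBracket_single]
        rw [show m + (l + n) = l + (m + n) by ring, show l + m + n = l + (m + n) by ring,
          ← Finsupp.single_add]
        congr 1
        push_cast
        ring

theorem cocycle_leibniz (x y z : ℤ →₀ F) :
    cocycle F x (wittBracket F y z) =
      cocycle F (wittBracket F x y) z + cocycle F y (wittBracket F x z) := by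
  induction x using Finsupp.induction_linear with
  | zero => simp
  | add x x' hx hx' => simp only [map_add, LinearMap.add_apply, hx, hx']; abel
  | single l a =>
    induction y using Finsupp.induction_linear with
    | zero => simp
    | add y y' hy hy' => simp only [map_add, LinearMap.add_apply, hy, hy']; abel
    | single m b =>
      induction z using Finsupp.induction_linear with
      | zero => simp
      | add z z' hz hz' => simp only [map_add, hz, hz']; abel
      | single n c =>
        simp only [wittBracket_single, cocycle_single]
        rw [show m + (l + n) = l + (m + n) by ring, show l + m + n = l + (m + n) by ring]
        split_ifs with h
        · have hj := central_jacobi F l m n (by omega)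
          have hn : central F (l + m) = - central F n := by
            rw [← central_neg]; congr 1; omega
          rw [hn]
          push_cast at hj ⊢
          linear_combination a * b * c * hj
        · simp

instance : Bracket (Vir F) (Vir F) :=
  ⟨fun x y => (coords F).symm (wittBracket F (coords F x).1 (coords F y).1,
    cocycle F (coords F x).1 (coords F y).1)⟩

theorem coords_lie (x y : Vir F) :
    coords F ⁅x, y⁆ = (wittBracket F (coords F x).1 (coords F y).1,
      cocycle F (coords F x).1 (coords F y).1) :=
  (coords F).apply_symm_apply _

instance : LieRing (Vir F) where
  add_lie x y z := by
    apply (coords F).injective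
    simp [coords_lie]
  lie_add x y z := by
    apply (coords F).injective
    simp [coords_lie]
  lie_self x := by
    apply (coords F).injective
    simp [coords_lie, wittBracket_self, cocycle_self]
  leibniz_lie x y z := by
    apply (coords F).injective
    rw [map_add]
    simp only [coords_lie, Prod.mk_add_mk]
    rw [wittBracket_leibniz, cocycle_leibniz]

instance : LieAlgebra F (Vir F) where
  lie_smul t x y := by
    apply (coords F).injective
    simp [coords_lie]

/-- The defining relation of the Virasoro algebra. -/
theorem lie_L_L (m n : ℤ) :
    ⁅L F m, L F n⁆ =
      ((m - n : ℤ) : F) • L F (m + n) + (if m + n = 0 then central F m else 0) • C F := by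
  apply (coords F).injective
  rw [map_add, map_smul, map_smul, coords_lie]
  simp only [L, C, LinearEquiv.apply_symm_apply, wittBracket_single, cocycle_single]
  split_ifs <;> simp

/-- The element `C` is central. -/
theorem lie_C (x : Vir F) : ⁅x, C F⁆ = 0 := by
  apply (coords F).injective
  rw [coords_lie]
  simp [C]

end Vir

/-! ### Verma modules and their irreducible quotients -/

section Verma

variable (F : Type*) [Field F] (c h : F)

/-- The image of `x` in the universal enveloping algebra of the Virasoro algebra. -/
def envι (x : Vir F) : UniversalEnvelopingAlgebra F (Vir F) := UniversalEnvelopingAlgebra.ι F x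

/-- The left ideal of `U(Vir)` generated by `L_n` for `n > 0`, `L_0 - h` and `C - c`. -/
def vermaIdeal : Submodule (UniversalEnvelopingAlgebra F (Vir F))
    (UniversalEnvelopingAlgebra F (Vir F)) :=
  Submodule.span _ ({u | ∃ n : ℤ, 0 < n ∧ u = envι F (Vir.L F n)} ∪
    {envι F (Vir.L F 0) - algebraMap F _ h, envι F (Vir.C F) - algebraMap F _ c})

/-- The Verma module `V(c,h)`, i.e. the module induced from the one-dimensional module of the
subalgebra spanned by `C` and `L_n`, `n ≥ 0`, on which `L_n` is `0` for `n > 0`, `L_0` is `h` and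
`C` is `c`. -/
def Verma : Type _ := UniversalEnvelopingAlgebra F (Vir F) ⧸ vermaIdeal F c h

namespace Verma

instance : AddCommGroup (Verma F c h) :=
  inferInstanceAs (AddCommGroup (UniversalEnvelopingAlgebra F (Vir F) ⧸ vermaIdeal F c h))

instance : Module (UniversalEnvelopingAlgebra F (Vir F)) (Verma F c h) :=
  inferInstanceAs (Module (UniversalEnvelopingAlgebra F (Vir F))
    (UniversalEnvelopingAlgebra F (Vir F) ⧸ vermaIdeal F c h))

instance : Module F (Verma F c h) :=
  inferInstanceAs (Module F (UniversalEnvelopingAlgebra F (Vir F) ⧸ vermaIdeal F c h))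

instance : IsScalarTower F (UniversalEnvelopingAlgebra F (Vir F)) (Verma F c h) :=
  inferInstanceAs (IsScalarTower F (UniversalEnvelopingAlgebra F (Vir F))
    (UniversalEnvelopingAlgebra F (Vir F) ⧸ vermaIdeal F c h))

instance : SMulCommClass (UniversalEnvelopingAlgebra F (Vir F)) F (Verma F c h) :=
  IsScalarTower.to_smulCommClass'

instance : LieRingModule (Vir F) (Verma F c h) where
  bracket x v := envι F x • v
  add_lie x y v := by
    change envι F (x + y) • v = _
    rw [envι, map_add, add_smul]; rfl
  lie_add x v w := smul_add _ v w
  leibniz_lie x y v := by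
    change envι F x • envι F y • v = envι F ⁅x, y⁆ • v + envι F y • envι F x • v
    rw [smul_smul, smul_smul, ← add_smul]
    congr 1
    simp only [envι, LieHom.map_lie, LieRing.of_associative_ring_bracket, sub_add_cancel]

instance : LieModule F (Vir F) (Verma F c h) where
  smul_lie t x v := by
    change envι F (t • x) • v = t • envι F x • v
    rw [envι, map_smul, smul_assoc]; rfl
  lie_smul t x v := smul_comm (envι F x) t v

/-- The highest weight vector `v_{c,h}`. -/
def hwv : Verma F c h :=
  Submodule.Quotient.mk (p := vermaIdeal F c h) (1 : UniversalEnvelopingAlgebra F (Vir F))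

/-- The vector `L_{-n₁} ⋯ L_{-n_k} v_{c,h}`. -/
def monomial (l : List ℕ) : Verma F c h :=
  l.foldr (fun n v => ⁅Vir.L F (-(n : ℤ)), v⁆) (hwv F c h)

/-- The degree `n` part `V(c,h)(n)`, spanned by the vectors `L_{-n₁} ⋯ L_{-n_k} v_{c,h}` with all
`n_i ≥ 1` and `n₁ + ⋯ + n_k = n` (those with `n₁ ≥ ⋯ ≥ n_k` span the same space). -/
def degreePart (n : ℕ) : Submodule F (Verma F c h) :=
  Submodule.span F (monomial F c h '' {l : List ℕ | (∀ i ∈ l, 1 ≤ i) ∧ l.sum = n})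

/-- A submodule `N` is graded if it is the sum of its intersections with the `V(c,h)(n)`. -/
def IsGraded (N : LieSubmodule F (Vir F) (Verma F c h)) : Prop :=
  N.toSubmodule = ⨆ n : ℕ, N.toSubmodule ⊓ degreePart F c h n

/-- The maximal graded submodule `W(c,h)`: the sum of all proper graded submodules. -/
def maxGraded : LieSubmodule F (Vir F) (Verma F c h) :=
  sSup {N | IsGraded F c h N ∧ N ≠ ⊤}

end Verma

/-- The irreducible highest weight module `L(c,h) = V(c,h) / W(c,h)`. -/
abbrev IrredHW : Type _ := Verma F c h ⧸ Verma.maxGraded F c h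

end Verma

/-! ### The fermionic Fock spaces -/

/-- The two index sets `Z` of the modes `a(n)`: `half` is `ℤ + 1/2` and `int` is `ℤ`. -/
inductive Sector
  | half
  | int

/-- Twice the shift: the integer `k` stands for the element `k + shift / 2` of `Z`. Thus the
indices `k` and `-k - shift` stand for opposite elements of `Z`. -/
def Sector.shift : Sector → ℤ
  | half => 1
  | int => 0

section Fock

variable (F : Type*) [Field F] (Z : Sector)

/-- The relations `a(m) a(n) + a(n) a(m) = δ_{m+n,0}`, `m, n ∈ Z`, with `m = k + shift / 2` and
`n = l + shift / 2`. -/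
inductive FermionRel : FreeAlgebra F ℤ → FreeAlgebra F ℤ → Prop
  | anticomm (k l : ℤ) : FermionRel
      (FreeAlgebra.ι F k * FreeAlgebra.ι F l + FreeAlgebra.ι F l * FreeAlgebra.ι F k)
      (if k + l + Z.shift = 0 then 1 else 0)

/-- The algebra `A(H,Z)` generated by the `a(n)`, `n ∈ Z`. -/
def FermionAlg : Type _ := RingQuot (FermionRel F Z)

instance : Ring (FermionAlg F Z) := inferInstanceAs (Ring (RingQuot (FermionRel F Z)))

instance : Algebra F (FermionAlg F Z) := inferInstanceAs (Algebra F (RingQuot (FermionRel F Z)))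

/-- The quotient map from the free algebra to `A(H,Z)`. -/
def FermionAlg.mk : FreeAlgebra F ℤ →ₐ[F] FermionAlg F Z := RingQuot.mkAlgHom F (FermionRel F Z)

/-- The generator `a(k + shift / 2)`. -/
def fermion (k : ℤ) : FermionAlg F Z := FermionAlg.mk F Z (FreeAlgebra.ι F k)

/-- The left ideal generated by the `a(n)` with `n > 0`. -/
def fockIdeal : Submodule (FermionAlg F Z) (FermionAlg F Z) :=
  Submodule.span _ {u | ∃ k : ℤ, 0 < 2 * k + Z.shift ∧ u = fermion F Z k}

/-- The Fock space `V(H,Z)`, i.e. the module induced from the one-dimensional module of the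
subalgebra generated by the `a(n)`, `n > 0`, on which these act as `0`. -/
def Fock : Type _ := FermionAlg F Z ⧸ fockIdeal F Z

namespace Fock

instance : AddCommGroup (Fock F Z) := inferInstanceAs (AddCommGroup (FermionAlg F Z ⧸ fockIdeal F Z))

instance : Module (FermionAlg F Z) (Fock F Z) :=
  inferInstanceAs (Module (FermionAlg F Z) (FermionAlg F Z ⧸ fockIdeal F Z))

instance : Module F (Fock F Z) := inferInstanceAs (Module F (FermionAlg F Z ⧸ fockIdeal F Z))

instance : IsScalarTower F (FermionAlg F Z) (Fock F Z) :=
  inferInstanceAs (IsScalarTower F (FermionAlg F Z) (FermionAlg F Z ⧸ fockIdeal F Z))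

instance : SMulCommClass (FermionAlg F Z) F (Fock F Z) := IsScalarTower.to_smulCommClass'

/-- The quotient map `A(H,Z) → V(H,Z)`, `u ↦ u 1`. -/
def mk : FermionAlg F Z →ₗ[FermionAlg F Z] Fock F Z := (fockIdeal F Z).mkQ

/-- The vacuum vector `1`. -/
def vac : Fock F Z := mk F Z 1

/-- The vector `a(n₁) ⋯ a(n_r) 1`. -/
def word (l : List ℤ) : Fock F Z := l.foldr (fun k v => fermion F Z k • v) (vac F Z)

/-- The parity parts `V(H,Z)_s`, spanned by the monomials of length congruent to `s` modulo `2`.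
All words in the `a(n)` are allowed; as the relations change the length by even numbers only, the
words `a(-n₁) ⋯ a(-n_r) 1` with `n₁ > ⋯ > n_r ≥ 0` span the same space. -/
def part (s : ZMod 2) : Submodule F (Fock F Z) :=
  Submodule.span F (word F Z '' {l : List ℤ | (l.length : ZMod 2) = s})

/-- The normal ordered product `:a(m) a(n):` for `m = k + shift / 2`, `n = l + shift / 2`. -/
def normalOrd (k l : ℤ) : FermionAlg F Z :=
  if k ≤ l then fermion F Z k * fermion F Z l else -(fermion F Z l * fermion F Z k)

/-- The summand `j :a(-j) a(n+j):` for `j = k + shift / 2`. -/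
def summand (n k : ℤ) : FermionAlg F Z :=
  ((k : F) + (Z.shift : F) / 2) • normalOrd F Z (-k - Z.shift) (n + k)

/-- The scalar added to the quadratic expression: `1/16` for `L(0)` if `Z = ℤ`. -/
def correction (n : ℤ) : F :=
  match Z with
  | .half => 0
  | .int => if n = 0 then 1 / 16 else 0

theorem fermion_anticomm (k l : ℤ) :
    fermion F Z k * fermion F Z l + fermion F Z l * fermion F Z k =
      if k + l + Z.shift = 0 then 1 else 0 := by
  have h := RingQuot.mkAlgHom_rel F (FermionRel.anticomm (F := F) (Z := Z) k l)
  change FermionAlg.mk F Z _ = FermionAlg.mk F Z _ at h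
  split_ifs at h ⊢ <;> simpa [fermion] using h

theorem fock_induction {P : Fock F Z → Prop} (hvac : P (vac F Z))
    (hadd : ∀ v w, P v → P w → P (v + w)) (hsmul : ∀ (t : F) v, P v → P (t • v))
    (hmode : ∀ k v, P v → P (fermion F Z k • v)) (v : Fock F Z) : P v := by
  have key : ∀ (x : FreeAlgebra F ℤ) (w : Fock F Z), P w →
      P (FermionAlg.mk F Z x • w) := by
    intro x
    induction x using FreeAlgebra.induction with
    | grade0 t => intro w hw; rw [AlgHom.commutes, algebraMap_smul]; exact hsmul t w hw
    | grade1 k => intro w hw; exact hmode k w hw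
    | mul x y hx hy => intro w hw; rw [map_mul, mul_smul]; exact hx _ (hy _ hw)
    | add x y hx hy => intro w hw; rw [map_add, add_smul]; exact hadd _ _ (hx _ hw) (hy _ hw)
  obtain ⟨u, rfl⟩ := Submodule.Quotient.mk_surjective _ v
  obtain ⟨x, rfl⟩ := RingQuot.mkAlgHom_surjective F (FermionRel F Z) u
  have := key x _ hvac
  rwa [vac, ← map_smul, smul_eq_mul, mul_one] at this

theorem fermion_eventually_zero (v : Fock F Z) : ∃ N : ℤ, ∀ k, N < k → fermion F Z k • v = 0 := by
  induction v using fock_induction with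
  | hvac =>
    refine ⟨0, fun k hk => ?_⟩
    rw [vac, ← map_smul, smul_eq_mul, mul_one]
    refine (Submodule.Quotient.mk_eq_zero _).2 ?_
    refine Submodule.subset_span ⟨k, ?_, rfl⟩
    cases Z <;> simp [Sector.shift] <;> omega
  | hadd v w hv hw =>
    obtain ⟨N, hN⟩ := hv
    obtain ⟨M, hM⟩ := hw
    exact ⟨max N M, fun k hk => by
      rw [smul_add, hN k (by omega), hM k (by omega), add_zero]⟩
  | hsmul t v hv =>
    obtain ⟨N, hN⟩ := hv
    exact ⟨N, fun k hk => by rw [smul_comm, hN k hk, smul_zero]⟩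
  | hmode l v hv =>
    obtain ⟨N, hN⟩ := hv
    refine ⟨max N (-l - Z.shift), fun k hk => ?_⟩
    have h := fermion_anticomm F Z k l
    rw [if_neg (by omega)] at h
    rw [smul_smul, eq_neg_of_add_eq_zero_left h, neg_smul, mul_smul, hN k (by omega), smul_zero,
      neg_zero]

theorem summand_finite (n : ℤ) (v : Fock F Z) :
    (Function.support fun k : ℤ => summand F Z n k • v).Finite := by
  obtain ⟨N, hN⟩ := fermion_eventually_zero F Z v
  refine (Set.finite_Icc (-N - Z.shift) (N - n)).subset fun k hk => ?_
  by_contra hk'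
  rw [Set.mem_Icc, not_and_or, not_le, not_le] at hk'
  refine hk ?_
  change summand F Z n k • v = 0
  rw [summand, smul_assoc, normalOrd]
  split_ifs with h
  · rw [mul_smul, hN _ (by omega), smul_zero, smul_zero]
  · rw [neg_smul, mul_smul, hN _ (by omega), smul_zero, neg_zero, smul_zero]

/-- The operator `L(n) = (1/2) ∑_{j ∈ Z} j :a(-j) a(n+j):` (plus `1/16` if `Z = ℤ` and `n = 0`);
on each vector only finitely many summands are nonzero. -/
def virOp (n : ℤ) : Module.End F (Fock F Z) where
  toFun v := correction F Z n • v + (1 / 2 : F) • ∑ᶠ k : ℤ, summand F Z n k • v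
  map_add' v w := by
    simp only [smul_add]
    rw [finsum_add_distrib (summand_finite F Z n v) (summand_finite F Z n w), smul_add]
    abel
  map_smul' t v := by
    have h : ∀ k : ℤ, summand F Z n k • t • v = t • summand F Z n k • v :=
      fun k => smul_comm _ t v
    simp only [h, RingHom.id_apply]
    rw [← smul_finsum' t (summand_finite F Z n v), smul_comm (correction F Z n) t v,
      smul_comm (1 / 2 : F) t, smul_add]

/-- The linear map from the Virasoro algebra to the endomorphisms of `V(H,Z)` with `L_n ↦ L(n)` and
`C ↦ 1/2`. -/
def action : Vir F →ₗ[F] Module.End F (Fock F Z) :=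
  (LinearMap.coprod (Finsupp.linearCombination F (virOp F Z))
    (LinearMap.toSpanSingleton F (Module.End F (Fock F Z)) ((1 / 2 : F) • 1))) ∘ₗ
      (Vir.coords F).toLinearMap

theorem action_L (n : ℤ) : action F Z (Vir.L F n) = virOp F Z n := by
  simp [action, Vir.L]

theorem action_C : action F Z (Vir.C F) = (1 / 2 : F) • (1 : Module.End F (Fock F Z)) := by
  simp [action, Vir.C]

theorem fermion_mem_part (k : ℤ) (s : ZMod 2) {v : Fock F Z} (hv : v ∈ part F Z s) :
    fermion F Z k • v ∈ part F Z (s + 1) := by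
  induction hv using Submodule.span_induction with
  | mem v hv =>
    obtain ⟨l, hl, rfl⟩ := hv
    refine Submodule.subset_span ⟨k :: l, ?_, rfl⟩
    have hl' : (l.length : ZMod 2) = s := hl
    simp [hl']
  | zero => simp
  | add v w _ _ hv hw => rw [smul_add]; exact add_mem hv hw
  | smul t v _ hv => rw [smul_comm]; exact Submodule.smul_mem _ t hv

theorem virOp_mem_part (n : ℤ) (s : ZMod 2) {v : Fock F Z} (hv : v ∈ part F Z s) :
    virOp F Z n v ∈ part F Z s := by
  have h2 : s + 1 + 1 = s := by rw [add_assoc, show (1 + 1 : ZMod 2) = 0 from rfl, add_zero]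
  have hq : ∀ k l : ℤ, (fermion F Z k * fermion F Z l) • v ∈ part F Z s := by
    intro k l
    have := fermion_mem_part F Z k _ (fermion_mem_part F Z l s hv)
    rwa [h2, smul_smul] at this
  refine add_mem (Submodule.smul_mem _ _ hv) (Submodule.smul_mem _ _ ?_)
  refine finsum_induction (· ∈ part F Z s) (zero_mem _) (fun _ _ => add_mem) fun k => ?_
  rw [summand, smul_assoc, normalOrd]
  refine Submodule.smul_mem _ _ ?_
  split_ifs
  · exact hq _ _
  · rw [neg_smul]; exact neg_mem (hq _ _)

theorem action_mem_part (x : Vir F) (s : ZMod 2) {v : Fock F Z} (hv : v ∈ part F Z s) :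
    action F Z x v ∈ part F Z s := by
  have h : action F Z x v = Finsupp.linearCombination F (virOp F Z) (Vir.coords F x).1 v +
      (Vir.coords F x).2 • (1 / 2 : F) • v := rfl
  rw [h]
  refine add_mem ?_ (Submodule.smul_mem _ _ (Submodule.smul_mem _ _ hv))
  rw [Finsupp.linearCombination_apply, Finsupp.sum, LinearMap.sum_apply]
  exact sum_mem fun n _ => Submodule.smul_mem _ _ (virOp_mem_part F Z n s hv)

/-- The restriction of the operators `L(n)` and `C = 1/2` to a parity part of `V(H,Z)`. -/
def partAction (s : ZMod 2) : Vir F →ₗ[F] Module.End F (part F Z s) where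
  toFun x := (action F Z x).restrict fun _ hv => action_mem_part F Z x s hv
  map_add' x y := by ext v; simp
  map_smul' t x := by ext v; simp

end Fock

end Fock

section Iso

variable {F : Type*} [Field F] {M : Type*} [AddCommGroup M] [Module F M]

/-- The operators `ρ x` on `M` make `M` a module for the Virasoro algebra. -/
def IsVirModule (ρ : Vir F →ₗ[F] Module.End F M) : Prop :=
  ∀ x y : Vir F, ρ ⁅x, y⁆ = ρ x * ρ y - ρ y * ρ x

/-- The operators `ρ x` make `M` a module for the Virasoro algebra, and this module is isomorphic
to `N`. -/
def VirIsomorphic (ρ : Vir F →ₗ[F] Module.End F M) (N : Type*) [AddCommGroup N] [Module F N]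
    [LieRingModule (Vir F) N] : Prop :=
  IsVirModule ρ ∧ ∃ φ : M ≃ₗ[F] N, ∀ (x : Vir F) (v : M), φ (ρ x v) = ⁅x, φ v⁆

end Iso

end

/-! The heart of the matter is that a subspace `N` of the Fock space stable under all `L(n)` is
stable under all products `a(r) a(s)` (`Fock.mode_mode_mem`). Fix `v` in `N` and a total index `d`,
and consider the classes of `a(r) a(d-r) v` modulo `N`; only finitely many are nonzero. It suffices
that every moment `∑ f(r) a(r) a(d-r) v`, with `f` a polynomial, vanishes modulo `N`. Polynomials
are measured by forward differences and tested in the binomial basis: in characteristic p the powers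
of `r` see only `r` mod p, whereas binomials separate all integers.

The moments are killed by induction on the degree `n`, and for each `n` one relation with nonzero
leading coefficient suffices. For `n` even, antisymmetry under `r ↦ d - r` gives it. For `n = 1` the
relation is the stability under `L(n)` itself. For odd `n ≥ 3`, take two quadratic fields with
polynomial weights of degrees `j` and `k`, `j + k + 1 = n`; their modes preserve `N` by induction,
hence so does their normal ordered product. In its Wick expansion the quartic term cancels, since
each field contains an undifferentiated copy of `a`, and the single contractions leave a relation of
degree `n` with leading coefficient `(-1)^j (n+1) C(n-1,j) - C(n+1,j+1)`. By `exists_lead_ne_zero`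
some `j` works. For `n = 3` the possible values are `0`, `-14`, `0`: this is where characteristic 7
is excluded.

Given stability under pairs, `Fock.eq_part_of_stable` shows that each parity part is irreducible:
annihilation operators reduce any nonzero vector to a combination of the vacuum and `a(0) 1`. The
Virasoro relations hold because the defect of each relation commutes with all modes, hence is a
scalar, computed by a vacuum expectation value (`Fock.defect_eq`).

Finally `Verma.virIsomorphic_irredHW` recognises `L(c,h)`. Weights of `L_0` do not separate degrees
in positive characteristic, so the grading is controlled by a functional that is `1` on the highest
weight vector and vanishes on the image of every `L_{-n}`, `n ≥ 1`. -/

noncomputable section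

/-! ### Polynomial functions on the integers via forward differences -/

section PolyLead

variable {F : Type*} [Field F]

/-- The `n`-th forward difference of `f` is the constant `c`; thus `f` is an integer-valued-type
polynomial of degree at most `n` whose coefficient at the binomial `x.choose n` is `c`. -/
def PolyLead : ℕ → F → (ℤ → F) → Prop
  | 0, c, f => ∀ x, f x = c
  | n + 1, c, f => PolyLead n c fun x => f (x + 1) - f x

namespace PolyLead

theorem congr_lead {n : ℕ} {c d : F} {f : ℤ → F} (h : PolyLead n c f) (hcd : c = d) :
    PolyLead n d f := hcd ▸ h

theorem add {n : ℕ} {c d : F} {f g : ℤ → F} (hf : PolyLead n c f) (hg : PolyLead n d g) :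
    PolyLead n (c + d) fun x => f x + g x := by
  induction n generalizing f g with
  | zero => intro x; simp only [hf x, hg x]
  | succ n ih =>
    have := ih (f := fun x => f (x + 1) - f x) (g := fun x => g (x + 1) - g x) hf hg
    simp only [PolyLead]
    convert this using 2
    ring

theorem const_mul {n : ℕ} {c : F} {f : ℤ → F} (t : F) (hf : PolyLead n c f) :
    PolyLead n (t * c) fun x => t * f x := by
  induction n generalizing f with
  | zero => intro x; simp only [hf x]
  | succ n ih =>
    have := ih (f := fun x => f (x + 1) - f x) hf
    simp only [PolyLead]
    convert this using 2
    ring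

theorem neg {n : ℕ} {c : F} {f : ℤ → F} (hf : PolyLead n c f) :
    PolyLead n (-c) fun x => - f x := by
  simpa using hf.const_mul (-1)

theorem sub {n : ℕ} {c d : F} {f g : ℤ → F} (hf : PolyLead n c f) (hg : PolyLead n d g) :
    PolyLead n (c - d) fun x => f x - g x := by
  simpa [sub_eq_add_neg] using hf.add hg.neg

theorem shift {n : ℕ} {c : F} {f : ℤ → F} (hf : PolyLead n c f) (d : ℤ) :
    PolyLead n c fun x => f (x + d) := by
  induction n generalizing f with
  | zero => intro x; exact hf _
  | succ n ih =>
    have := ih (f := fun x => f (x + 1) - f x) hf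
    simp only [PolyLead]
    convert this using 4
    ring

theorem reflect {n : ℕ} {c : F} {f : ℤ → F} (hf : PolyLead n c f) (d : ℤ) :
    PolyLead n ((-1) ^ n * c) fun x => f (d - x) := by
  induction n generalizing f d with
  | zero => intro x; simpa using hf _
  | succ n ih =>
    have := (ih (f := fun x => f (x + 1) - f x) hf (d - 1)).neg
    simp only [PolyLead]
    convert this using 1
    · ring
    · funext x
      rw [show d - (x + 1) = d - 1 - x by ring, show d - 1 - x + 1 = d - x by ring]
      ring

theorem succ_zero {n : ℕ} {c : F} {f : ℤ → F} (hf : PolyLead n c f) : PolyLead (n + 1) 0 f := by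
  induction n generalizing f with
  | zero => intro x; simp only [hf _, sub_self]
  | succ n ih => exact ih (f := fun x => f (x + 1) - f x) hf

theorem of_lt {m n : ℕ} {c : F} {f : ℤ → F} (hf : PolyLead m c f) (hmn : m < n) :
    PolyLead n 0 f := by
  induction n, hmn using Nat.le_induction with
  | base => exact hf.succ_zero
  | succ n _ ih => exact ih.succ_zero

/-- A function on `ℤ` with zero difference is constant; so a polynomial of degree at most `n`
acquires a leading coefficient that can be cancelled against another. -/
theorem exists_of_succ_zero {n : ℕ} {f : ℤ → F} (hf : PolyLead (n + 1) 0 f) :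
    ∃ c, PolyLead n c f := by
  induction n generalizing f with
  | zero =>
    have hs : ∀ x, f (x + 1) = f x := fun x => sub_eq_zero.1 (hf x)
    refine ⟨f 0, fun x => ?_⟩
    induction x using Int.induction_on with
    | zero => rfl
    | succ i ih => rw [hs, ih]
    | pred i ih => rw [← ih, ← hs]; congr 1; ring
  | succ n ih => exact ih (f := fun x => f (x + 1) - f x) hf

/-- The difference of `f g` is `Δf · g(·+1) + f · Δg`, and the two leading coefficients combine by
Pascal's rule. The binomial factor comes from normalising against `x.choose n` rather than `x ^ n`.
-/
theorem mul {j k : ℕ} {a b : F} {f g : ℤ → F} (hf : PolyLead j a f) (hg : PolyLead k b g) :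
    PolyLead (j + k) (((j + k).choose j : F) * (a * b)) fun x => f x * g x := by
  induction h : j + k generalizing j k a b f g with
  | zero =>
    obtain ⟨rfl, rfl⟩ : j = 0 ∧ k = 0 := by omega
    intro x
    simp [hf x, hg x]
  | succ m ih =>
    cases j with
    | zero =>
      obtain rfl : k = m + 1 := by omega
      have := hg.const_mul a
      simp only [hf _, Nat.choose_zero_right, Nat.cast_one, one_mul]
      exact this
    | succ j =>
      cases k with
      | zero =>
        obtain rfl : j = m := by omega
        have := hf.const_mul b
        simp only [hg _, Nat.choose_self, Nat.cast_one, one_mul, mul_comm _ b]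
        exact this
      | succ k =>
        have h1 := ih (f := fun x => f (x + 1) - f x) hf (hg.shift 1) (by omega)
        have h2 := ih (g := fun x => g (x + 1) - g x) hf hg (by omega)
        simp only [PolyLead]
        convert h1.add h2 using 1
        · rw [Nat.choose_succ_succ]
          push_cast
          ring
        · funext x
          ring

/-- The binomial polynomials with a prescribed zero. -/
theorem choose (b : ℤ) (j : ℕ) :
    PolyLead j (1 : F) fun x => ((Ring.choose (x - b) j : ℤ) : F) := by
  induction j with
  | zero => intro x; simp
  | succ j ih =>
    simp only [PolyLead]
    convert ih using 2 with x
    rw [show x + 1 - b = x - b + 1 by ring, Ring.choose_succ_succ]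
    push_cast
    ring

end PolyLead

end PolyLead

/-! ### Normal ordered products of fermionic modes -/

section Clifford

variable {F : Type*} [Field F] {V : Type*} [AddCommGroup V] [Module F V]

/-- Operators `a k` (`k : ℤ`, standing for the mode `k + σ / 2`) that satisfy the Clifford relations
and are locally annihilated by the modes of large index. -/
structure CliffordModes (σ : ℤ) (a : ℤ → Module.End F V) : Prop where
  anticomm : ∀ k l v, a k (a l v) + a l (a k v) = if k + l + σ = 0 then v else 0
  eventually_zero : ∀ v, ∃ N : ℤ, ∀ k, N < k → a k v = 0

/-- The step function with value `1`, `1/2`, `0` at positive, zero and negative modes. -/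
def modeStep (F : Type*) [Field F] (σ k : ℤ) : F :=
  if 0 < 2 * k + σ then 1 else if 2 * k + σ = 0 then 1 / 2 else 0

theorem modeStep_add (h2 : (2 : F) ≠ 0) {σ k l : ℤ} (h : k + l + σ = 0) :
    modeStep F σ k + modeStep F σ l = 1 := by
  obtain rfl : l = -k - σ := by omega
  unfold modeStep
  rcases lt_trichotomy (2 * k + σ) 0 with h | h | h
  · rw [if_neg (by omega), if_neg (by omega), if_pos (by omega)]; simp
  · rw [if_neg (by omega), if_pos (by omega), if_neg (by omega), if_pos (by omega)]
    field_simp; norm_num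
  · rw [if_pos (by omega), if_neg (by omega), if_neg (by omega)]; simp

/-- The contraction of two modes. -/
def contraction (F : Type*) [Field F] (σ k l : ℤ) : F :=
  if k + l + σ = 0 then modeStep F σ k else 0

theorem contraction_add (h2 : (2 : F) ≠ 0) (σ k l : ℤ) :
    contraction F σ k l + contraction F σ l k = if k + l + σ = 0 then 1 else 0 := by
  unfold contraction
  by_cases h : k + l + σ = 0
  · rw [if_pos h, if_pos (by omega), if_pos h, modeStep_add h2 h]
  · rw [if_neg h, if_neg (by omega), if_neg h, add_zero]

theorem contraction_eq_zero {σ k l : ℤ} (h : 0 < 2 * l + σ) : contraction F σ k l = 0 := by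
  unfold contraction modeStep
  split_ifs <;> first | rfl | omega

/-- The quadratic expression `a k a l` minus its contraction. -/
def wick (σ : ℤ) (a : ℤ → Module.End F V) (k l : ℤ) : Module.End F V :=
  a k * a l - contraction F σ k l • 1

theorem wick_apply (σ : ℤ) (a : ℤ → Module.End F V) (k l : ℤ) (v : V) :
    wick σ a k l v = a k (a l v) - contraction F σ k l • v := by
  simp [wick]

/-- The normal ordered product of four modes. -/
def quartic (σ : ℤ) (a : ℤ → Module.End F V) (k l m n : ℤ) (v : V) : V :=
  a k (a l (a m (a n v))) -
    (contraction F σ k l • a m (a n v) - contraction F σ k m • a l (a n v) +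
      contraction F σ k n • a l (a m v) + contraction F σ l m • a k (a n v) -
      contraction F σ l n • a k (a m v) + contraction F σ m n • a k (a l v)) +
    (contraction F σ k l * contraction F σ m n - contraction F σ k m * contraction F σ l n +
      contraction F σ k n * contraction F σ l m) • v

namespace CliffordModes

variable {σ : ℤ} {a : ℤ → Module.End F V}

theorem apply_apply (ha : CliffordModes σ a) (h2 : (2 : F) ≠ 0) (k l : ℤ) (v : V) :
    a k (a l v) = (contraction F σ k l + contraction F σ l k) • v - a l (a k v) := by
  rw [contraction_add h2, eq_sub_iff_add_eq, ha.anticomm]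
  split_ifs <;> simp

/-- The two contractions add up to the anticommutator, so subtracting them leaves an antisymmetric
expression. -/
theorem wick_swap (ha : CliffordModes σ a) (h2 : (2 : F) ≠ 0)
    (k l : ℤ) (v : V) : wick σ a l k v = - wick σ a k l v := by
  rw [wick_apply, wick_apply, ha.apply_apply h2 l k]
  module

/-- A large index in the right slot kills both the vector and the contraction; antisymmetry
transfers this to the left slot. -/
theorem wick_eventually_zero (ha : CliffordModes σ a) (h2 : (2 : F) ≠ 0) (v : V) :
    ∃ B : ℤ, 0 ≤ B ∧ ∀ k l, (B < k ∨ B < l) → wick σ a k l v = 0 := by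
  obtain ⟨N, hN⟩ := ha.eventually_zero v
  have key : ∀ k l, max (max N (-σ)) 0 < l → wick σ a k l v = 0 := fun k l hl => by
    rw [wick_apply, hN l (by omega), contraction_eq_zero (by omega), map_zero, zero_smul, sub_zero]
  refine ⟨max (max N (-σ)) 0, le_max_right _ _, fun k l h => ?_⟩
  rcases h with h | h
  · rw [ha.wick_swap h2 l k, key l k h, neg_zero]
  · exact key k l h

/-- Together with the next two transpositions this gives total antisymmetry of the normal ordered
quartic; all other symmetries are composed from these three. -/
theorem quartic_swap₁₂ (ha : CliffordModes σ a) (h2 : (2 : F) ≠ 0) (k l m n : ℤ) (v : V) :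
    quartic σ a l k m n v = - quartic σ a k l m n v := by
  unfold quartic
  simp only [ha.apply_apply h2 l k]
  module

theorem quartic_swap₂₃ (ha : CliffordModes σ a) (h2 : (2 : F) ≠ 0) (k l m n : ℤ) (v : V) :
    quartic σ a k m l n v = - quartic σ a k l m n v := by
  unfold quartic
  simp only [ha.apply_apply h2 m l, map_sub, map_smul]
  module

theorem quartic_swap₃₄ (ha : CliffordModes σ a) (h2 : (2 : F) ≠ 0) (k l m n : ℤ) (v : V) :
    quartic σ a k l n m v = - quartic σ a k l m n v := by
  unfold quartic
  simp only [ha.apply_apply h2 n m, map_sub, map_smul]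
  module

theorem quartic_swap₂₄ (ha : CliffordModes σ a) (h2 : (2 : F) ≠ 0) (k l m n : ℤ) (v : V) :
    quartic σ a k n m l v = - quartic σ a k l m n v := by
  rw [ha.quartic_swap₂₃ h2 k m n l, ha.quartic_swap₃₄ h2 k m l n, ha.quartic_swap₂₃ h2 k l m n,
    neg_neg]

theorem quartic_swap_pairs (ha : CliffordModes σ a) (h2 : (2 : F) ≠ 0) (k l m n : ℤ) (v : V) :
    quartic σ a m n k l v = quartic σ a k l m n v := by
  rw [ha.quartic_swap₂₃ h2 m k n l, ha.quartic_swap₁₂ h2 k m n l, ha.quartic_swap₃₄ h2 k m l n,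
    ha.quartic_swap₂₃ h2 k l m n]
  simp

theorem quartic_eventually_zero (ha : CliffordModes σ a) (h2 : (2 : F) ≠ 0)
    (v : V) : ∃ B : ℤ, ∀ k l m n,
    (B < k ∨ B < l ∨ B < m ∨ B < n) → quartic σ a k l m n v = 0 := by
  obtain ⟨N, hN⟩ := ha.eventually_zero v
  have key : ∀ k l m n, max (max N (-σ)) 0 < n → quartic σ a k l m n v = 0 := fun k l m n hn => by
    have hc : ∀ k, contraction F σ k n = 0 := fun k => contraction_eq_zero (by omega)
    simp [quartic, hN n (by omega), hc]
  refine ⟨max (max N (-σ)) 0, fun k l m n h => ?_⟩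
  rcases h with h | h | h | h
  · rw [ha.quartic_swap₁₂ h2 l k m n, ha.quartic_swap₂₄ h2 l n m k, key _ _ _ _ h]; simp
  · rw [ha.quartic_swap₂₄ h2 k n m l, key _ _ _ _ h]; simp
  · rw [ha.quartic_swap₃₄ h2 k l n m, key _ _ _ _ h]; simp
  · exact key _ _ _ _ h

end CliffordModes

/-! ### Wick's theorem modulo a subspace -/

/-- The class of `a k a l v` modulo the subspace `N`. -/
def pairClass (a : ℤ → Module.End F V) (N : Submodule F V) (v : V) (k l : ℤ) : V ⧸ N :=
  N.mkQ (a k (a l v))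

/-- The contraction of two modes, expanded in the opposite order if `P` holds. -/
def orderedContraction (F : Type*) [Field F] (σ : ℤ) (P : Prop) [Decidable P] (k l : ℤ) : F :=
  if k + l + σ = 0 then modeStep F σ k - (if P then 1 else 0) else 0

namespace CliffordModes

variable {σ : ℤ} {a : ℤ → Module.End F V}
  {N : Submodule F V} {v : V}

/-- The anticommutator is a multiple of `v`, hence zero modulo `N`. -/
theorem pairClass_swap (ha : CliffordModes σ a) (h2 : (2 : F) ≠ 0) (hv : v ∈ N)
    (k l : ℤ) : pairClass a N v l k = - pairClass a N v k l := by
  have : N.mkQ v = 0 := by simpa using hv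
  rw [pairClass, pairClass, ha.apply_apply h2 l k, map_sub, map_smul, this, smul_zero, zero_sub]

theorem mkQ_wick (hv : v ∈ N) (k l : ℤ) : N.mkQ (wick σ a k l v) = pairClass a N v k l := by
  have : N.mkQ v = 0 := by simpa using hv
  rw [wick_apply, map_sub, map_smul, this, smul_zero, sub_zero, pairClass]

theorem pairClass_eventually_zero (ha : CliffordModes σ a) (h2 : (2 : F) ≠ 0) (hv : v ∈ N) :
    ∃ B : ℤ, 0 ≤ B ∧ ∀ k l, (B < k ∨ B < l) → pairClass a N v k l = 0 := by
  obtain ⟨B, hB0, hB⟩ := ha.wick_eventually_zero h2 v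
  exact ⟨B, hB0, fun k l h => by rw [← mkQ_wick (σ := σ) hv, hB k l h, map_zero]⟩

/-- Wick's theorem for the product of two quadratic expressions, in either order. -/
theorem mkQ_wick_wick (ha : CliffordModes σ a) (h2 : (2 : F) ≠ 0) (hv : v ∈ N)
    (P : Prop) [Decidable P] (k l m n : ℤ) :
    (if P then N.mkQ (wick σ a m n (wick σ a k l v)) else N.mkQ (wick σ a k l (wick σ a m n v))) =
      N.mkQ (quartic σ a k l m n v)
      - orderedContraction F σ P k m • pairClass a N v l n
      + orderedContraction F σ P k n • pairClass a N v l m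
      + orderedContraction F σ P l m • pairClass a N v k n
      - orderedContraction F σ P l n • pairClass a N v k m := by
  -- Double contractions are multiples of `v`, so only the quartic term and the single contractions
  -- survive modulo `N`.
  have hv0 : N.mkQ v = 0 := by simpa using hv
  have key : ∀ k l m n : ℤ, N.mkQ (wick σ a k l (wick σ a m n v)) =
      N.mkQ (quartic σ a k l m n v)
      - contraction F σ k m • pairClass a N v l n
      + contraction F σ k n • pairClass a N v l m
      + contraction F σ l m • pairClass a N v k n
      - contraction F σ l n • pairClass a N v k m := by
    intro k l m n
    simp only [wick_apply, quartic, pairClass, map_sub, map_add, map_smul, hv0]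
    module
  split_ifs with hP
  -- Reversing the two factors turns `contraction i j` into `-contraction j i`, which for paired
  -- indices is `contraction i j - 1`.
  · have hc : ∀ i j, orderedContraction F σ P i j = - contraction F σ j i := by
      intro i j
      have := contraction_add h2 σ i j
      rw [orderedContraction]
      rw [contraction] at this
      split_ifs at this ⊢
      · linear_combination this
      · rw [zero_add] at this; rw [this, neg_zero]
    rw [key, ha.quartic_swap_pairs h2, ha.pairClass_swap h2 hv l n, ha.pairClass_swap h2 hv k n,
      ha.pairClass_swap h2 hv l m, ha.pairClass_swap h2 hv k m]
    simp only [hc]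
    module
  · have hc : ∀ i j, orderedContraction F σ P i j = contraction F σ i j := by
      intro i j
      simp [orderedContraction, contraction, hP]
    rw [key]
    simp only [hc]

end CliffordModes

end Clifford

/-! ### Moments of pairs of modes -/

section Moments

open Function

variable {F : Type*} [Field F] {V : Type*} [AddCommGroup V] [Module F V]

/-- The sum of `φ x` over the interval between the zero mode and `-y`, with orientation. -/
def stepSum (σ : ℤ) (φ : ℤ → F) (y : ℤ) : F :=
  ∑ᶠ x : ℤ, φ x * (modeStep F σ x - if 0 < x + y then 1 else 0)

theorem modeStep_sub_eq_zero {σ x y : ℤ} (h : (σ.natAbs : ℤ) + y.natAbs < x.natAbs) :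
    (modeStep F σ x - if 0 < x + y then 1 else 0) = 0 := by
  unfold modeStep
  rcases lt_or_ge 0 x with hx | hx
  · rw [if_pos (by omega), if_pos (by omega), sub_self]
  · rw [if_neg (by omega), if_neg (by omega), if_neg (by omega), sub_self]

theorem stepSum_finite (σ : ℤ) (φ : ℤ → F) (y : ℤ) :
    HasFiniteSupport fun x : ℤ => φ x * (modeStep F σ x - if 0 < x + y then 1 else 0) := by
  refine (Set.finite_Icc (-((σ.natAbs : ℤ) + y.natAbs)) ((σ.natAbs : ℤ) + y.natAbs)).subset ?_
  intro x hx
  by_contra hx'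
  refine hx ?_
  rw [Set.mem_Icc, not_and_or] at hx'
  change φ x * _ = 0
  rw [modeStep_sub_eq_zero (by omega), mul_zero]

/-- Raising `y` by one moves the threshold of the second step across the single point `x = -y`. -/
theorem stepSum_succ (σ : ℤ) (φ : ℤ → F) (y : ℤ) :
    stepSum σ φ (y + 1) - stepSum σ φ y = - φ (-y) := by
  rw [stepSum, stepSum, ← finsum_sub_distrib (stepSum_finite σ φ (y + 1)) (stepSum_finite σ φ y),
    finsum_eq_single _ (-y)]
  · simp only [neg_add_cancel_left, neg_add_cancel, zero_lt_one, if_true, lt_irrefl, if_false]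
    ring
  · intro x hx
    by_cases h : 0 < x + y
    · rw [if_pos h, if_pos (by omega), sub_self]
    · rw [if_neg h, if_neg (by omega), sub_self]

/-- Summation raises the degree by one, because the difference of `stepSum` is the reflected
function up to sign. This extra degree is what lets moments below `n` control the moment of degree
`n`. -/
theorem PolyLead.stepSum {k : ℕ} {c : F} {φ : ℤ → F} (hφ : PolyLead k c φ) (σ : ℤ) :
    PolyLead (k + 1) ((-1) ^ (k + 1) * c) (stepSum σ φ) := by
  simp only [PolyLead, stepSum_succ]
  convert (hφ.reflect 0).neg using 1
  · ring
  · simp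

/-- All moments of degree less than `n` of the pairs `a r a (d - r) v`, `v ∈ N`, vanish
modulo `N`. -/
def MomentsVanish (a : ℤ → Module.End F V) (N : Submodule F V) (n : ℕ) : Prop :=
  ∀ v ∈ N, ∀ d : ℤ, ∀ f : ℤ → F, PolyLead n 0 f →
    ∑ᶠ r : ℤ, f r • pairClass a N v r (d - r) = 0

namespace CliffordModes

variable {σ : ℤ} {a : ℤ → Module.End F V}
  {N : Submodule F V}

theorem wick_sum_finite (ha : CliffordModes σ a) (h2 : (2 : F) ≠ 0) (f : ℤ → F) (d : ℤ) (v : V) :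
    HasFiniteSupport fun r : ℤ => f r • wick σ a r (d - r) v := by
  obtain ⟨B, -, hB⟩ := ha.wick_eventually_zero h2 v
  refine (Set.finite_Icc (d - B) B).subset fun r hr => ?_
  by_contra hr'
  rw [Set.mem_Icc, not_and_or] at hr'
  refine hr ?_
  change f r • wick σ a r (d - r) v = 0
  rw [hB _ _ (by omega), smul_zero]

theorem pairClass_sum_finite (ha : CliffordModes σ a) (h2 : (2 : F) ≠ 0)
    (f : ℤ → F) (d : ℤ) {v : V} (hv : v ∈ N) :
    HasFiniteSupport fun r : ℤ => f r • pairClass a N v r (d - r) := by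
  obtain ⟨B, -, hB⟩ := ha.pairClass_eventually_zero h2 hv
  refine (Set.finite_Icc (d - B) B).subset fun r hr => ?_
  by_contra hr'
  rw [Set.mem_Icc, not_and_or] at hr'
  refine hr ?_
  change f r • pairClass a N v r (d - r) = 0
  rw [hB _ _ (by omega), smul_zero]

/-- Lifts the vanishing of moments from classes to vectors: the weighted sums of normal ordered
pairs are operators preserving `N`, so they can be composed. -/
theorem sum_wick_mem (ha : CliffordModes σ a) (h2 : (2 : F) ≠ 0)
    {n : ℕ} (hn : MomentsVanish a N n) {f : ℤ → F} (hf : PolyLead n 0 f)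
    (d : ℤ) {v : V} (hv : v ∈ N) : ∑ᶠ r : ℤ, f r • wick σ a r (d - r) v ∈ N := by
  rw [← Submodule.Quotient.mk_eq_zero, ← Submodule.mkQ_apply,
    map_finsum N.mkQ (ha.wick_sum_finite h2 f d v)]
  simp only [map_smul, mkQ_wick hv]
  exact hn v hv d f hf

theorem iterated_sum_eq_zero (ha : CliffordModes σ a) (h2 : (2 : F) ≠ 0)
    {n : ℕ} (hn : MomentsVanish a N n) {f h : ℤ → F}
    (hf : PolyLead n 0 f) (hh : PolyLead n 0 h) (m d : ℤ) {v : V} (hv : v ∈ N) :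
    ∑ᶠ t : ℤ, ∑ᶠ r : ℤ,
      (f r * h t) • N.mkQ (wick σ a t (d - t) (wick σ a r (m - r) v)) = 0 := by
  have hw := ha.sum_wick_mem h2 hn hf m hv
  have key := hn _ hw d h hh
  rw [← key]
  refine finsum_congr fun t => ?_
  rw [← mkQ_wick (σ := σ) hw, ← LinearMap.comp_apply,
    map_finsum (N.mkQ ∘ₗ wick σ a t (d - t)) (ha.wick_sum_finite h2 f m v), smul_finsum]
  refine finsum_congr fun r => ?_
  rw [map_smul, smul_smul, mul_comm, LinearMap.comp_apply]

/-- For a fixed value `m` of the index sum of the first factor, the sum is a composite of two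
operators preserving `N`, in the order dictated by the sign of `m`. This order is that of the normal
ordered product of two fields and keeps the total sum finite. -/
theorem product_sum_eq_zero (ha : CliffordModes σ a) (h2 : (2 : F) ≠ 0)
    {n : ℕ} (hn : MomentsVanish a N n) {f h : ℤ → F}
    (hf : PolyLead n 0 f) (hh : PolyLead n 0 h) (d : ℤ) {v : V} (hv : v ∈ N)
    (hfin : HasFiniteSupport fun p : ℤ × ℤ × ℤ => (f p.1 * h p.2.2) •
      (if 0 < p.1 + p.2.1
        then N.mkQ (wick σ a p.2.2 (d - p.1 - p.2.1 - p.2.2) (wick σ a p.1 p.2.1 v))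
        else N.mkQ (wick σ a p.1 p.2.1 (wick σ a p.2.2 (d - p.1 - p.2.1 - p.2.2) v)))) :
    ∑ᶠ p : ℤ × ℤ × ℤ, (f p.1 * h p.2.2) •
      (if 0 < p.1 + p.2.1
        then N.mkQ (wick σ a p.2.2 (d - p.1 - p.2.1 - p.2.2) (wick σ a p.1 p.2.1 v))
        else N.mkQ (wick σ a p.1 p.2.1 (wick σ a p.2.2 (d - p.1 - p.2.1 - p.2.2) v))) = 0 := by
  -- New coordinates `(m, r, t)`, where `m = r + s` is the index sum of the first factor.
  let e : ℤ × ℤ × ℤ ≃ ℤ × ℤ × ℤ :=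
    { toFun := fun p => (p.2.1, p.1 - p.2.1, p.2.2)
      invFun := fun p => (p.1 + p.2.1, p.1, p.2.2)
      left_inv := fun p => by simp
      right_inv := fun p => by simp }
  rw [← finsum_comp_equiv e, finsum_curry₃ _ (hfin.preimage e.injective.injOn)]
  refine (finsum_congr fun m => ?_).trans finsum_zero
  have hu : ∀ r t : ℤ, d - r - (m - r) - t = d - m - t := fun r t => by ring
  have hfin' : HasFiniteSupport fun q : ℤ × ℤ => (f q.1 * h q.2) •
      (if 0 < m
        then N.mkQ (wick σ a q.2 (d - m - q.2) (wick σ a q.1 (m - q.1) v))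
        else N.mkQ (wick σ a q.1 (m - q.1) (wick σ a q.2 (d - m - q.2) v))) := by
    have hi : Injective fun q : ℤ × ℤ => (q.1, m - q.1, q.2) := by
      rintro ⟨x, y⟩ ⟨x', y'⟩ h
      simp only [Prod.mk.injEq] at h ⊢
      exact ⟨h.1, h.2.2⟩
    refine (hfin.preimage hi.injOn).subset fun q hq => ?_
    simpa only [Set.mem_preimage, mem_support, hu, add_sub_cancel] using hq
  change ∑ᶠ r : ℤ, ∑ᶠ t : ℤ, (f r * h t) •
      (if 0 < r + (m - r)
        then N.mkQ (wick σ a t (d - r - (m - r) - t) (wick σ a r (m - r) v))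
        else N.mkQ (wick σ a r (m - r) (wick σ a t (d - r - (m - r) - t) v))) = 0
  simp only [hu, add_sub_cancel]
  by_cases hm : 0 < m
  · simp only [if_pos hm] at hfin' ⊢
    rw [← ha.iterated_sum_eq_zero h2 hn hf hh m (d - m) hv]
    have h1 := finsum_curry _ hfin'
    have h3 := finsum_curry _ (hfin'.preimage (Equiv.prodComm ℤ ℤ).injective.injOn)
    rw [← h1]
    refine Eq.trans ?_ h3
    exact (finsum_comp_equiv (Equiv.prodComm ℤ ℤ)).symm
  · simp only [if_neg hm]
    simp only [mul_comm (f _)]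
    exact ha.iterated_sum_eq_zero h2 hn hh hf (d - m) m hv

/-- Here `x` is contracted with `z`, forcing `z = -x - σ`, while `y` survives; summing over `x` and
`z` produces the coefficient `stepSum` of the remaining pair. -/
theorem contraction_sum (ha : CliffordModes σ a) (h2 : (2 : F) ≠ 0)
    (Φ : ℤ → ℤ → F) (d : ℤ) {v : V} (hv : v ∈ N) :
    (HasFiniteSupport fun p : ℤ × ℤ × ℤ =>
      (Φ p.1 p.2.1 * orderedContraction F σ (0 < p.1 + p.2.1) p.1 p.2.2) •
        pairClass a N v p.2.1 (d - p.2.1)) ∧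
    ∑ᶠ p : ℤ × ℤ × ℤ, (Φ p.1 p.2.1 * orderedContraction F σ (0 < p.1 + p.2.1) p.1 p.2.2) •
        pairClass a N v p.2.1 (d - p.2.1) =
      ∑ᶠ y : ℤ, stepSum σ (fun x => Φ x y) y • pairClass a N v y (d - y) := by
  obtain ⟨B, hB0, hB⟩ := ha.pairClass_eventually_zero h2 hv
  have hfin : HasFiniteSupport fun p : ℤ × ℤ × ℤ =>
      (Φ p.1 p.2.1 * orderedContraction F σ (0 < p.1 + p.2.1) p.1 p.2.2) •
        pairClass a N v p.2.1 (d - p.2.1) := by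
    -- A nonzero term has `d - B ≤ y ≤ B`, then `|x| ≤ |σ| + |y|`, and `z = -x - σ` costs one more
    -- `|σ|`.
    obtain ⟨K, hK⟩ : ∃ K : ℤ, K = B + d.natAbs + 2 * σ.natAbs := ⟨_, rfl⟩
    refine ((Set.finite_Icc (-K) K).prod
      ((Set.finite_Icc (-K) K).prod (Set.finite_Icc (-K) K))).subset fun p hp => ?_
    by_contra hp'
    refine hp ?_
    obtain ⟨x, y, z⟩ := p
    simp only [Set.mem_prod, Set.mem_Icc] at hp'
    change (Φ x y * orderedContraction F σ (0 < x + y) x z) • pairClass a N v y (d - y) = 0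
    by_cases hy : B < y ∨ B < d - y
    · rw [hB _ _ hy, smul_zero]
    · rw [orderedContraction]
      split_ifs with hxz hxy
      · have := modeStep_sub_eq_zero (F := F) (σ := σ) (x := x) (y := y) (by omega)
        rw [if_pos hxy] at this
        rw [this, mul_zero, zero_smul]
      · have := modeStep_sub_eq_zero (F := F) (σ := σ) (x := x) (y := y) (by omega)
        rw [if_neg hxy] at this
        rw [this, mul_zero, zero_smul]
      · rw [mul_zero, zero_smul]
  refine ⟨hfin, ?_⟩
  let e : ℤ × ℤ × ℤ ≃ ℤ × ℤ × ℤ :=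
    { toFun := fun p => (p.2.1, p.1, p.2.2)
      invFun := fun p => (p.2.1, p.1, p.2.2)
      left_inv := fun p => rfl
      right_inv := fun p => rfl }
  rw [← finsum_comp_equiv e, finsum_curry₃ _ (hfin.preimage e.injective.injOn)]
  refine finsum_congr fun y => ?_
  rw [stepSum, finsum_smul' (stepSum_finite σ (fun x => Φ x y) y)]
  refine finsum_congr fun x => ?_
  change ∑ᶠ z : ℤ, (Φ x y * orderedContraction F σ (0 < x + y) x z) •
    pairClass a N v y (d - y) = _
  rw [finsum_eq_single _ (-x - σ)]
  · rw [orderedContraction, if_pos (by ring)]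
  · intro z hz
    rw [orderedContraction, if_neg (by omega), mul_zero, zero_smul]

/-- The weights involve only slots 1 and 3, while the quartic changes sign when slots 2 and 4 are
exchanged; the sum therefore equals its negative. -/
theorem quartic_sum (ha : CliffordModes σ a) (h2 : (2 : F) ≠ 0) (f h : ℤ → F) (d : ℤ) (v : V) :
    (HasFiniteSupport fun p : ℤ × ℤ × ℤ =>
      (f p.1 * h p.2.2) •
        N.mkQ (quartic σ a p.1 p.2.1 p.2.2 (d - p.1 - p.2.1 - p.2.2) v)) ∧
    ∑ᶠ p : ℤ × ℤ × ℤ, (f p.1 * h p.2.2) •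
        N.mkQ (quartic σ a p.1 p.2.1 p.2.2 (d - p.1 - p.2.1 - p.2.2) v) = 0 := by
  obtain ⟨B, hB⟩ := ha.quartic_eventually_zero h2 v
  constructor
  · refine ((Set.finite_Icc (d - 3 * B) B).prod
      ((Set.finite_Icc (d - 3 * B) B).prod (Set.finite_Icc (d - 3 * B) B))).subset fun p hp => ?_
    by_contra hp'
    refine hp ?_
    obtain ⟨x, y, z⟩ := p
    simp only [Set.mem_prod, Set.mem_Icc] at hp'
    change (f x * h z) • N.mkQ (quartic σ a x y z (d - x - y - z) v) = 0
    rw [hB _ _ _ _ (by omega), map_zero, smul_zero]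
  · let e : ℤ × ℤ × ℤ ≃ ℤ × ℤ × ℤ :=
      { toFun := fun p => (p.1, d - p.1 - p.2.1 - p.2.2, p.2.2)
        invFun := fun p => (p.1, d - p.1 - p.2.1 - p.2.2, p.2.2)
        left_inv := fun p => by ext <;> simp; ring
        right_inv := fun p => by ext <;> simp; ring }
    have key : ∑ᶠ p : ℤ × ℤ × ℤ, (f p.1 * h p.2.2) •
        N.mkQ (quartic σ a p.1 p.2.1 p.2.2 (d - p.1 - p.2.1 - p.2.2) v) =
        - ∑ᶠ p : ℤ × ℤ × ℤ, (f p.1 * h p.2.2) •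
        N.mkQ (quartic σ a p.1 p.2.1 p.2.2 (d - p.1 - p.2.1 - p.2.2) v) := by
      conv_lhs => rw [← finsum_comp_equiv e]
      rw [← finsum_neg_distrib]
      refine finsum_congr fun p => ?_
      obtain ⟨x, y, z⟩ := p
      change (f x * h z) • N.mkQ (quartic σ a x (d - x - y - z) z
        (d - x - (d - x - y - z) - z) v) =
        -((f x * h z) • N.mkQ (quartic σ a x y z (d - x - y - z) v))
      rw [show d - x - (d - x - y - z) - z = y by ring, ha.quartic_swap₂₄ h2 x y z, map_neg,
        smul_neg]
    rw [eq_neg_iff_add_eq_zero, ← two_smul F] at key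
    exact (smul_eq_zero.1 key).resolve_left h2

end CliffordModes

theorem stepSum_mul_const (σ : ℤ) (φ : ℤ → F) (c : F) (y : ℤ) :
    stepSum σ (fun x => φ x * c) y = c * stepSum σ φ y := by
  rw [stepSum, stepSum, ← smul_eq_mul, smul_finsum]
  refine finsum_congr fun x => ?_
  rw [smul_eq_mul]
  ring

namespace CliffordModes

variable {σ : ℤ} {a : ℤ → Module.End F V}
  {N : Submodule F V}

/-- Transports `contraction_sum` along a relabelling of the slots, so that it serves all four cross
contractions. -/
theorem contraction_sum_equiv (ha : CliffordModes σ a) (h2 : (2 : F) ≠ 0)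
    (Φ : ℤ → ℤ → F) (d : ℤ) {v : V} (hv : v ∈ N)
    (e : ℤ × ℤ × ℤ ≃ ℤ × ℤ × ℤ) {P : ℤ × ℤ × ℤ → V ⧸ N}
    (hP : ∀ p, P p = (Φ (e p).1 (e p).2.1 *
      orderedContraction F σ (0 < (e p).1 + (e p).2.1) (e p).1 (e p).2.2) •
        pairClass a N v (e p).2.1 (d - (e p).2.1)) :
    HasFiniteSupport P ∧
      ∑ᶠ p, P p = ∑ᶠ y : ℤ, stepSum σ (fun x => Φ x y) y • pairClass a N v y (d - y) := by
  have h := ha.contraction_sum h2 Φ d hv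
  obtain rfl : P = _ := funext hP
  exact ⟨h.1.preimage e.injective.injOn, (finsum_comp_equiv e).trans h.2⟩

/-- The relation between pairs that results from Wick's theorem for the normal ordered product of
two quadratic fields with a common factor. -/
theorem wick_relation (ha : CliffordModes σ a) (h2 : (2 : F) ≠ 0)
    {n : ℕ} (hn : MomentsVanish a N n) {f h : ℤ → F}
    (hf : PolyLead n 0 f) (hh : PolyLead n 0 h) (d : ℤ) {v : V} (hv : v ∈ N) :
    ∑ᶠ y : ℤ, (-stepSum σ (fun x => f x * h (-σ - x)) y + h (d - y) * stepSum σ f y +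
      f y * stepSum σ (fun x => h (-σ - x)) y -
      f y * h (d - y) * stepSum σ (fun _ => 1) y) • pairClass a N v y (d - y) = 0 := by
  -- The total index is `d - σ` because a contracted pair carries `-σ`, leaving total `d` for the
  -- surviving pair.
  have hQ := ha.quartic_sum h2 (N := N) f h (d - σ) v
  -- The four terms contract slots (1,3), (1,4), (2,3), (2,4). In each, `x` is the contracted slot
  -- of the first factor and `y` is its partner, which survives.
  have h1 := ha.contraction_sum_equiv h2 (fun x _ => f x * h (-σ - x)) d hv (Equiv.refl _)
    (P := fun p => (f p.1 * h p.2.2) • (orderedContraction F σ (0 < p.1 + p.2.1) p.1 p.2.2 •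
      pairClass a N v p.2.1 (d - σ - p.1 - p.2.1 - p.2.2))) (by
    rintro ⟨r, s, t⟩
    simp only [Equiv.refl_apply, orderedContraction]
    by_cases hc : r + t + σ = 0
    · obtain rfl : t = -σ - r := by omega
      rw [smul_smul, show d - σ - r - s - (-σ - r) = d - s by ring]
      rfl
    · simp [hc])
  have h3 := ha.contraction_sum_equiv h2 (fun x y => f x * h (d - y)) d hv
    { toFun := fun p => (p.1, p.2.1, d - σ - p.1 - p.2.1 - p.2.2)
      invFun := fun p => (p.1, p.2.1, d - σ - p.1 - p.2.1 - p.2.2)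
      left_inv := fun p => by ext <;> simp
      right_inv := fun p => by ext <;> simp }
    (P := fun p => (f p.1 * h p.2.2) • (orderedContraction F σ (0 < p.1 + p.2.1) p.1
      (d - σ - p.1 - p.2.1 - p.2.2) • pairClass a N v p.2.1 p.2.2)) (by
    rintro ⟨r, s, t⟩
    simp only [Equiv.coe_fn_mk, orderedContraction]
    by_cases hc : r + (d - σ - r - s - t) + σ = 0
    · obtain rfl : t = d - s := by omega
      rw [smul_smul]
    · simp [hc])
  have h4 := ha.contraction_sum_equiv h2 (fun x y => h (-σ - x) * f y) d hv
    { toFun := fun p => (p.2.1, p.1, p.2.2)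
      invFun := fun p => (p.2.1, p.1, p.2.2)
      left_inv := fun p => rfl
      right_inv := fun p => rfl }
    (P := fun p => (f p.1 * h p.2.2) • (orderedContraction F σ (0 < p.1 + p.2.1) p.2.1 p.2.2 •
      pairClass a N v p.1 (d - σ - p.1 - p.2.1 - p.2.2))) (by
    rintro ⟨r, s, t⟩
    simp only [Equiv.coe_fn_mk, orderedContraction, add_comm s r]
    by_cases hc : s + t + σ = 0
    · obtain rfl : t = -σ - s := by omega
      rw [smul_smul, show d - σ - r - s - (-σ - s) = d - r by ring, mul_comm (f r)]
    · simp [hc])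
  have h5 := ha.contraction_sum_equiv h2 (fun _ y => 1 * (f y * h (d - y))) d hv
    { toFun := fun p => (p.2.1, p.1, d - σ - p.1 - p.2.1 - p.2.2)
      invFun := fun p => (p.2.1, p.1, d - σ - p.1 - p.2.1 - p.2.2)
      left_inv := fun p => by ext <;> simp; ring
      right_inv := fun p => by ext <;> simp; ring }
    (P := fun p => (f p.1 * h p.2.2) • (orderedContraction F σ (0 < p.1 + p.2.1) p.2.1
      (d - σ - p.1 - p.2.1 - p.2.2) • pairClass a N v p.1 p.2.2)) (by
    rintro ⟨r, s, t⟩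
    simp only [Equiv.coe_fn_mk, orderedContraction, add_comm s r]
    by_cases hc : s + (d - σ - r - s - t) + σ = 0
    · obtain rfl : t = d - r := by omega
      rw [smul_smul, one_mul]
    · simp [hc])
  have hE : ∀ p : ℤ × ℤ × ℤ, (f p.1 * h p.2.2) •
      (if 0 < p.1 + p.2.1
        then N.mkQ (wick σ a p.2.2 (d - σ - p.1 - p.2.1 - p.2.2) (wick σ a p.1 p.2.1 v))
        else N.mkQ (wick σ a p.1 p.2.1 (wick σ a p.2.2 (d - σ - p.1 - p.2.1 - p.2.2) v))) = _ :=
    fun p => by rw [ha.mkQ_wick_wick h2 hv, smul_sub, smul_add, smul_add, smul_sub]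
  have hzero := ha.product_sum_eq_zero h2 hn hf hh (d - σ) hv (by
    simp only [hE]
    exact (((hQ.1.fun_sub h1.1).fun_add h3.1).fun_add h4.1).fun_sub h5.1)
  simp only [hE] at hzero
  rw [finsum_sub_distrib (((hQ.1.fun_sub h1.1).fun_add h3.1).fun_add h4.1) h5.1,
    finsum_add_distrib ((hQ.1.fun_sub h1.1).fun_add h3.1) h4.1,
    finsum_add_distrib (hQ.1.fun_sub h1.1) h3.1, finsum_sub_distrib hQ.1 h1.1,
    hQ.2, h1.2, h3.2, h4.2, h5.2, zero_sub] at hzero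
  have hg := fun f => ha.pairClass_sum_finite h2 (N := N) f d hv
  simp only [sub_smul, add_smul, neg_smul]
  simp only [stepSum_mul_const] at hzero
  rw [finsum_sub_distrib, finsum_add_distrib, finsum_add_distrib, finsum_neg_distrib]
  · exact hzero
  all_goals first | exact hg _ | (simp only [← neg_smul, ← add_smul]; exact hg _)

/-- Any polynomial of degree `n` is a multiple of the one in the relation plus a polynomial of lower
degree. -/
theorem momentsVanish_succ_of_relation (ha : CliffordModes σ a) (h2 : (2 : F) ≠ 0)
    {n : ℕ} (hn : MomentsVanish a N n)
    (h : ∀ v ∈ N, ∀ d : ℤ, ∃ f : ℤ → F, ∃ c : F, c ≠ 0 ∧ PolyLead n c f ∧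
      ∑ᶠ r : ℤ, f r • pairClass a N v r (d - r) = 0) : MomentsVanish a N (n + 1) := by
  intro v hv d f hf
  obtain ⟨c, hc⟩ := hf.exists_of_succ_zero
  obtain ⟨g, b, hb, hg, hsum⟩ := h v hv d
  have hfg := hn v hv d _ ((hc.sub (hg.const_mul (c / b))).congr_lead (by field_simp; ring))
  simp only [sub_smul, mul_smul] at hfg
  have hfin : HasFiniteSupport fun r : ℤ => (c / b) • g r • pairClass a N v r (d - r) := by
    simp only [smul_smul]
    exact ha.pairClass_sum_finite h2 _ d hv
  rw [finsum_sub_distrib (ha.pairClass_sum_finite h2 _ d hv) hfin, ← smul_finsum, hsum, smul_zero,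
    sub_zero] at hfg
  exact hfg

/-- For even `n` the reflection `r ↦ d - r` preserves the leading coefficient, so `f` minus its
reflection has lower degree; by antisymmetry of pairs its moment is twice that of `f`. -/
theorem momentsVanish_succ_of_even (ha : CliffordModes σ a) (h2 : (2 : F) ≠ 0)
    {n : ℕ} (hn : MomentsVanish a N n) (he : Even n) :
    MomentsVanish a N (n + 1) := by
  intro v hv d f hf
  obtain ⟨c, hc⟩ := hf.exists_of_succ_zero
  have hr := hn v hv d _ ((hc.sub (hc.reflect d)).congr_lead (by rw [he.neg_one_pow]; ring))
  simp only [sub_smul] at hr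
  rw [finsum_sub_distrib (ha.pairClass_sum_finite h2 _ d hv)
    (ha.pairClass_sum_finite h2 (fun x => f (d - x)) d hv)] at hr
  have hs : ∑ᶠ r : ℤ, f (d - r) • pairClass a N v r (d - r) =
      - ∑ᶠ r : ℤ, f r • pairClass a N v r (d - r) := by
    rw [← finsum_comp_equiv (Equiv.subLeft d), ← finsum_neg_distrib]
    refine finsum_congr fun r => ?_
    simp only [Equiv.subLeft_apply, sub_sub_cancel]
    rw [ha.pairClass_swap h2 hv r (d - r), smul_neg]
  rw [hs, sub_neg_eq_add, ← two_smul F] at hr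
  exact (smul_eq_zero.1 hr).resolve_left h2

end CliffordModes

/-- Up to invertible factors, `j = 1` gives `(n+1)(3n-2)`, and `j = 2` leads to `(n+1)(n-1)(n-3)`.
If `n + 1` is nonzero in `F` and both vanish, then `n = 1` or `n = 3` in `F`, so `1 = 0` or `7 = 0`.
-/
theorem exists_lead_ne_zero (h2 : (2 : F) ≠ 0) (h7 : (7 : F) ≠ 0) {n : ℕ} (hn : Odd n)
    (hn3 : 3 ≤ n) : ∃ j < n, ((-1) ^ j * (n + 1) * ((n - 1).choose j : F) -
      ((n + 1).choose (j + 1) : F)) ≠ 0 := by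
  by_contra! hall
  obtain ⟨m, rfl⟩ : ∃ m, n = m + 3 := ⟨n - 3, by omega⟩
  have e1 := hall 1 (by omega)
  have e2 := hall 2 (by omega)
  -- When `n + 1 = 0` in `F`, all inner binomials `C(n+1,i)` would vanish, and the alternating sum
  -- of the row would reduce to its ends `1 + 1`.
  by_cases h0 : ((m + 3 : ℕ) : F) + 1 = 0
  · have hz : ∀ j < m + 3, ((m + 3 + 1).choose (j + 1) : F) = 0 := fun j hj => by
      have := hall j hj
      rwa [h0, mul_zero, zero_mul, zero_sub, neg_eq_zero] at this
    have halt := congrArg (Int.cast : ℤ → F)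
      (Int.alternating_sum_range_choose_of_ne (n := m + 3 + 1) (by omega))
    rw [Finset.sum_range_succ, Finset.sum_range_succ'] at halt
    push_cast at halt
    rw [Finset.sum_eq_zero] at halt
    · have : Even (m + 3 + 1) := hn.add_one
      rw [this.neg_one_pow] at halt
      simp at halt
      apply h2
      linear_combination halt
    · intro j hj
      have := hz j (Finset.mem_range.1 hj)
      rw [this, mul_zero]
  · have c1 : (((m + 3 + 1).choose 2 : ℕ) : F) * 2 = (m + 4) * (m + 3) := by
      have := Nat.choose_two_right (m + 4)
      have h' : (m + 4).choose 2 * 2 = (m + 4) * (m + 3) := by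
        rw [this, Nat.div_mul_cancel]
        · rfl
        · exact (Nat.even_mul_pred_self (m + 4)).two_dvd
      simpa only [Nat.cast_mul, Nat.cast_add, Nat.cast_ofNat, Nat.cast_one] using
        congrArg (Nat.cast : ℕ → F) h'
    have c2 : (((m + 2).choose 2 : ℕ) : F) * 2 = (m + 2) * (m + 1) := by
      have := Nat.choose_two_right (m + 2)
      have h' : (m + 2).choose 2 * 2 = (m + 2) * (m + 1) := by
        rw [this, Nat.div_mul_cancel]
        · rfl
        · exact (Nat.even_mul_pred_self (m + 2)).two_dvd
      simpa only [Nat.cast_mul, Nat.cast_add, Nat.cast_ofNat, Nat.cast_one] using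
        congrArg (Nat.cast : ℕ → F) h'
    have c3 : (((m + 3 + 1).choose 3 : ℕ) : F) * 3 = ((m + 3 + 1).choose 2 : ℕ) * (m + 2) := by
      have := Nat.choose_succ_right_eq (m + 3 + 1) 2
      rw [show m + 3 + 1 - 2 = m + 2 by omega] at this
      simpa only [Nat.cast_mul, Nat.cast_add, Nat.cast_ofNat, Nat.reduceAdd] using
        congrArg (Nat.cast : ℕ → F) this
    simp only [Nat.choose_one_right, Nat.reduceAdd] at e1 e2
    rw [show m + 3 - 1 = m + 2 by omega] at e1 e2
    push_cast at *
    have f1 : (m + 3 + 1 : F) * (3 * m + 7) = 0 := by linear_combination -2 * e1 - c1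
    have f2 : (m + 3 + 1 : F) * ((m + 2) * m) * 2 = 0 := by
      -- The identity is cleared of denominators without inverting 3, so characteristic 3 is
      -- covered.
      linear_combination 6 * e2 - 3 * (m + 3 + 1) * c2 + 2 * c3 + (m + 2) * c1
    have g1 : (3 * m + 7 : F) = 0 := (mul_eq_zero.1 f1).resolve_left h0
    have g2 : ((m + 2) * m : F) = 0 :=
      (mul_eq_zero.1 ((mul_eq_zero.1 f2).resolve_right h2)).resolve_left h0
    rcases mul_eq_zero.1 g2 with h | h
    · apply one_ne_zero (α := F)
      linear_combination g1 - 3 * h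
    · apply h7
      linear_combination g1 - 3 * h

namespace CliffordModes

variable {σ : ℤ} {a : ℤ → Module.End F V}
  {N : Submodule F V}

theorem momentsVanish_succ_of_odd (ha : CliffordModes σ a) (h2 : (2 : F) ≠ 0)
    (h7 : (7 : F) ≠ 0) {n : ℕ} (hn : MomentsVanish a N n)
    (hodd : Odd n) (hn3 : 3 ≤ n) : MomentsVanish a N (n + 1) := by
  obtain ⟨j, hj, hne⟩ := exists_lead_ne_zero h2 h7 hodd hn3
  obtain ⟨k, rfl⟩ : ∃ k, n = j + k + 1 := ⟨n - 1 - j, by omega⟩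
  refine ha.momentsVanish_succ_of_relation h2 hn fun v hv d => ?_
  -- Both weights have degree below `n = j + k + 1`, so the induction hypothesis applies to them;
  -- the summation in `stepSum` restores the missing degree.
  have hf := PolyLead.choose (F := F) 0 j
  have hh := PolyLead.choose (F := F) 0 k
  have l1 := ((hf.mul (hh.reflect (-σ))).stepSum σ).neg
  have l2 := (hh.reflect d).mul (hf.stepSum σ)
  have l3 := hf.mul ((hh.reflect (-σ)).stepSum σ)
  have hone : PolyLead 0 (1 : F) fun _ => 1 := fun _ => rfl
  have l4 := (hf.mul (hh.reflect d)).mul (hone.stepSum σ)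
  rw [show k + (j + 1) = j + k + 1 by ring] at l2
  refine ⟨_, _, ?_, ((l1.add l2).add l3).sub l4,
    ha.wick_relation h2 hn (hf.of_lt (by omega)) (hh.of_lt (by omega)) d hv⟩
  -- Since `n` is odd, `j + k` is even, and all signs reduce to the single sign `ε = (-1) ^ j`.
  have hs : (-1 : F) ^ k = (-1) ^ j := by
    have : Even (j + k) := by
      rcases hodd with ⟨m, hm⟩
      exact ⟨m, by omega⟩
    rcases Nat.even_add.1 this with h
    by_cases hj : Even j
    · rw [hj.neg_one_pow, (h.1 hj).neg_one_pow]
    · rw [(Nat.not_even_iff_odd.1 hj).neg_one_pow,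
        (Nat.not_even_iff_odd.1 (fun hk => hj (h.2 hk))).neg_one_pow]
  have hsq : (-1 : F) ^ j * (-1) ^ j = 1 := by rw [← mul_pow]; simp
  have hchoose : ((j + k + 1 + 1).choose (j + 1) : F) =
      (j + k + 1).choose j + (j + k + 1).choose k := by
    rw [Nat.choose_succ_succ (j + k + 1) j, Nat.cast_add]
    congr 2
    rw [← Nat.choose_symm_of_eq_add (show j + k + 1 = j + 1 + k by ring)]
  have hjk : (j + k + 1).choose (j + k) = j + k + 1 := by
    rw [Nat.choose_succ_self_right]
  rw [hchoose, Nat.add_sub_cancel] at hne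
  convert hne using 1
  rw [show j + (k + 1) = j + k + 1 by ring, hjk]
  simp only [pow_succ, pow_add, pow_zero, hs]
  push_cast
  generalize (-1 : F) ^ j = ε at *
  linear_combination (ε * ((j + k).choose j : F) - ((j + k + 1).choose k : F) -
    ((j + k + 1).choose j : F)) * hsq

/-- A subspace on which the linear moments vanish is stable under all products of two modes. -/
theorem pair_mem (ha : CliffordModes σ a) (h2 : (2 : F) ≠ 0) (h7 : (7 : F) ≠ 0)
    (hlin : ∀ v ∈ N, ∀ d : ℤ, ∃ f : ℤ → F, ∃ c : F, c ≠ 0 ∧ PolyLead 1 c f ∧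
      ∑ᶠ r : ℤ, f r • pairClass a N v r (d - r) = 0)
    {v : V} (hv : v ∈ N) (r s : ℤ) : a r (a s v) ∈ N := by
  have hall : ∀ n, MomentsVanish a N n := by
    intro n
    induction n with
    | zero =>
      intro v hv d f hf
      have : ∀ r, f r = 0 := hf
      simp [this]
    | succ n ih =>
      rcases Nat.even_or_odd n with he | ho
      · exact ha.momentsVanish_succ_of_even h2 ih he
      · rcases (show n = 1 ∨ 3 ≤ n by rcases ho with ⟨m, hm⟩; omega) with rfl | h3
        · exact ha.momentsVanish_succ_of_relation h2 ih hlin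
        · exact ha.momentsVanish_succ_of_odd h2 h7 ih ho h3
  obtain ⟨B, -, hB⟩ := ha.pairClass_eventually_zero h2 hv
  obtain ⟨d, rfl⟩ : ∃ d, s = d - r := ⟨r + s, by ring⟩
  -- Descending induction on `r` from the bound `B`: possible nonzero pairs have `d - B ≤ r ≤ B`.
  have key : ∀ i : ℕ, ∀ r : ℤ, B - i < r → pairClass a N v r (d - r) = 0 := by
    intro i
    induction i with
    | zero => intro r hr; exact hB _ _ (Or.inl (by simpa using hr))
    | succ i ih =>
      intro r hr
      by_cases hr' : B - i < r
      · exact ih r hr'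
      by_cases hd : B < d - r
      · exact hB _ _ (Or.inr hd)
      obtain ⟨l, hl⟩ : ∃ l : ℕ, r = d - B + l := ⟨(r - (d - B)).toNat, by omega⟩
      -- The binomial of degree `l` based at `d - B` vanishes at the points `d - B, …, r - 1` and
      -- equals `1` at `r`; pairs above `r` vanish by induction and those below `d - B` by the
      -- bound.
      have hsum := hall (l + 1) v hv d _ (PolyLead.choose (F := F) (d - B) l).succ_zero
      rw [finsum_eq_single _ r] at hsum
      · simpa [hl, Ring.choose_natCast] using hsum
      · intro x hx
        rcases lt_or_ge r x with h | h
        · rw [ih x (by push_cast at hr; omega), smul_zero]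
        by_cases hx' : B < d - x
        · rw [hB _ _ (Or.inr hx'), smul_zero]
        obtain ⟨m, hm⟩ : ∃ m : ℕ, x - (d - B) = m := ⟨(x - (d - B)).toNat, by omega⟩
        rw [hm, Ring.choose_natCast, Nat.choose_eq_zero_of_lt (by omega)]
        simp
  have := key (B - r + 1).toNat r (by omega)
  simpa [pairClass] using this

end CliffordModes

end Moments

/-! ### Modes and Virasoro operators on the Fock space -/

section FockModes

open Function

namespace Fock

variable (F : Type*) [Field F] (Z : Sector)

/-- The operator of the mode `k + shift / 2` on the Fock space. -/
def mode (k : ℤ) : Module.End F (Fock F Z) := Algebra.lsmul F F (Fock F Z) (fermion F Z k)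

variable {F Z}

theorem mode_apply (k : ℤ) (v : Fock F Z) : mode F Z k v = fermion F Z k • v := rfl

theorem cliffordModes : CliffordModes Z.shift (mode F Z) where
  anticomm k l v := by
    rw [mode_apply, mode_apply, mode_apply, mode_apply, smul_smul, smul_smul, ← add_smul,
      fermion_anticomm]
    split_ifs <;> simp
  eventually_zero := fermion_eventually_zero F Z

theorem mode_mode (k l : ℤ) (v : Fock F Z) : mode F Z k (mode F Z l v) =
    (if k + l + Z.shift = 0 then v else 0) - mode F Z l (mode F Z k v) :=
  eq_sub_of_add_eq (cliffordModes.anticomm k l v)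

theorem mode_mode_of_ne {k l : ℤ} (h : k + l + Z.shift ≠ 0) (v : Fock F Z) :
    mode F Z k (mode F Z l v) = - mode F Z l (mode F Z k v) := by
  rw [mode_mode, if_neg h, zero_sub]

theorem mode_vac {k : ℤ} (hk : 0 < 2 * k + Z.shift) : mode F Z k (vac F Z) = 0 := by
  rw [mode_apply, vac, ← map_smul, smul_eq_mul, mul_one]
  exact (Submodule.Quotient.mk_eq_zero _).2 (Submodule.subset_span ⟨k, hk, rfl⟩)

theorem mode_self (h2 : (2 : F) ≠ 0) {k : ℤ} (hk : 2 * k + Z.shift ≠ 0) (v : Fock F Z) :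
    mode F Z k (mode F Z k v) = 0 := by
  have h := (cliffordModes (F := F) (Z := Z)).anticomm k k v
  rw [if_neg (by omega), ← two_smul F] at h
  exact (smul_eq_zero.1 h).resolve_left h2

theorem normalOrd_smul (k l : ℤ) (v : Fock F Z) : normalOrd F Z k l • v =
    mode F Z k (mode F Z l v) - if l < k ∧ k + l + Z.shift = 0 then v else 0 := by
  rw [normalOrd]
  split_ifs with h1 h3 h3
  · omega
  · rw [mul_smul, sub_zero]; rfl
  · rw [mode_mode, if_pos h3.2, neg_smul, mul_smul, sub_sub_cancel_left]; rfl
  · rw [mode_mode, if_neg (by omega), neg_smul, mul_smul, zero_sub, sub_zero]; rfl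

theorem normalOrd_smul_mode (x y k : ℤ) (v : Fock F Z) :
    normalOrd F Z x y • mode F Z k v - mode F Z k (normalOrd F Z x y • v) =
      (if y + k + Z.shift = 0 then mode F Z x v else 0) -
        (if x + k + Z.shift = 0 then mode F Z y v else 0) := by
  rw [normalOrd_smul, normalOrd_smul, map_sub, mode_mode y k, map_sub, mode_mode x k]
  split_ifs <;> simp <;> abel

theorem virOp_apply (n : ℤ) (v : Fock F Z) : virOp F Z n v = correction F Z n • v +
    (1 / 2 : F) • ∑ᶠ k : ℤ, summand F Z n k • v := rfl

theorem summand_smul (n k : ℤ) (v : Fock F Z) : summand F Z n k • v =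
    ((k : F) + (Z.shift : F) / 2) • normalOrd F Z (-k - Z.shift) (n + k) • v := by
  rw [summand, smul_assoc]

/-- The commutation relation of the Virasoro operators and the modes. -/
theorem virOp_mode (h2 : (2 : F) ≠ 0) (n k : ℤ) (v : Fock F Z) :
    virOp F Z n (mode F Z k v) = mode F Z k (virOp F Z n v) -
      ((k : F) + (Z.shift : F) / 2 + (n : F) / 2) • mode F Z (n + k) v := by
  have hs : ∀ (x : ℤ) (w : Fock F Z),
      HasFiniteSupport fun l : ℤ => if l = x then ((l : F) + (Z.shift : F) / 2) • w else 0 := by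
    intro x w
    refine (Set.finite_singleton x).subset fun l hl => ?_
    by_contra h
    exact hl (if_neg h)
  have key : ∑ᶠ l : ℤ, summand F Z n l • mode F Z k v -
      mode F Z k (∑ᶠ l : ℤ, summand F Z n l • v) =
      -((2 * k : F) + Z.shift + n) • mode F Z (n + k) v := by
    rw [map_finsum (mode F Z k) (summand_finite F Z n v), ← finsum_sub_distrib
      (summand_finite F Z n _) (Set.Finite.subset (summand_finite F Z n v) ?_)]
    · have : ∀ l : ℤ, summand F Z n l • mode F Z k v - mode F Z k (summand F Z n l • v) =
          (if l = -n - k - Z.shift then ((l : F) + (Z.shift : F) / 2) • mode F Z (n + k) v else 0)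
          - (if l = k then ((l : F) + (Z.shift : F) / 2) • mode F Z (n + k) v else 0) := by
        intro l
        rw [summand_smul, summand_smul, map_smul, ← smul_sub, normalOrd_smul_mode, smul_sub]
        congr 1
        · by_cases h : l = -n - k - Z.shift
          · rw [if_pos h, if_pos (by omega), show -l - Z.shift = n + k by omega]
          · rw [if_neg h, if_neg (by omega), smul_zero]
        · by_cases h : l = k
          · rw [if_pos h, if_pos (by omega), h]
          · rw [if_neg h, if_neg (by omega), smul_zero]
      simp only [this]
      rw [finsum_sub_distrib (hs _ _) (hs _ _), finsum_eq_single _ (-n - k - Z.shift)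
        (fun l hl => if_neg hl), finsum_eq_single _ k (fun l hl => if_neg hl), if_pos rfl,
        if_pos rfl, ← sub_smul]
      congr 1
      push_cast
      field_simp
      ring
    · intro l hl h
      exact hl (by simp only [h, map_zero])
  rw [sub_eq_iff_eq_add] at key
  have hc : (k : F) + (Z.shift : F) / 2 + (n : F) / 2 = 1 / 2 * (2 * k + Z.shift + n) := by
    field_simp
  rw [virOp_apply, virOp_apply, map_add, map_smul, map_smul, key, hc]
  module

/-- A subspace stable under the Virasoro operators is stable under products of two modes. -/
theorem mode_mode_mem (h2 : (2 : F) ≠ 0) (h7 : (7 : F) ≠ 0) {N : Submodule F (Fock F Z)}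
    (hN : ∀ n, ∀ v ∈ N, virOp F Z n v ∈ N) {v : Fock F Z} (hv : v ∈ N) (r s : ℤ) :
    mode F Z r (mode F Z s v) ∈ N := by
  refine cliffordModes.pair_mem h2 h7 (fun v hv d => ?_) hv r s
  -- The weight `j` of `:a(-j) a(n+j):` expressed through the index `r` of `a(-j)`; the operator
  -- used is `L(d + shift)`. Normal ordering and the constant change it only by multiples of `v`.
  refine ⟨fun r => (((-r - Z.shift : ℤ) : F) + (Z.shift : F) / 2), -1, by simp, ?_, ?_⟩
  · intro x
    push_cast
    ring
  · have hv0 : N.mkQ v = 0 := by simpa using hv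
    have h := hN (d + Z.shift) v hv
    rw [← Submodule.Quotient.mk_eq_zero, ← Submodule.mkQ_apply, virOp_apply, map_add, map_smul,
      map_smul, hv0, smul_zero, zero_add, map_finsum _ (summand_finite F Z _ v)] at h
    have h' := (smul_eq_zero.1 h).resolve_left (by simpa using h2)
    rw [← h', ← finsum_comp_equiv (Equiv.subLeft (-Z.shift))]
    refine finsum_congr fun r => ?_
    rw [summand_smul, map_smul, normalOrd_smul, map_sub]
    simp only [Equiv.subLeft_apply, pairClass]
    have : N.mkQ (if d + Z.shift + r < -r - Z.shift ∧
        -r - Z.shift + (d + Z.shift + r) + Z.shift = 0 then v else 0) = 0 := by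
      split_ifs
      · exact hv0
      · exact map_zero _
    rw [this, sub_zero, show -(-Z.shift - r) - Z.shift = r by ring,
      show d - (-Z.shift - r) = d + Z.shift + r by ring, show -Z.shift - r = -r - Z.shift by ring]

end Fock

end FockModes

/-! ### The vacuum functional, parity and irreducibility of the Fock space -/

section FockStructure

open Function

namespace Fock

variable {F : Type*} [Field F] {Z : Sector}

/-! ### Maps out of the Fock space and of the fermion algebra -/

/-- Linear maps out of the Fock space. -/
def lift {M : Type*} [AddCommGroup M] [Module F M] (g : FermionAlg F Z →ₗ[F] M)
    (hg : ∀ u k, 0 < 2 * k + Z.shift → g (u * fermion F Z k) = 0) : Fock F Z →ₗ[F] M :=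
  (Submodule.liftQ ((fockIdeal F Z).restrictScalars F) g (by
    intro u hu
    rw [Submodule.restrictScalars_mem] at hu
    rw [LinearMap.mem_ker]
    rw [← one_mul u]
    -- Vanishing is proved for all left multiples `w * u` at once, since `g` is only `F`-linear
    -- while the span is a left ideal.
    refine Submodule.span_induction (p := fun u _ => ∀ w, g (w * u) = 0) ?_ ?_ ?_ ?_ hu 1
    · rintro _ ⟨k, hk, rfl⟩ w
      exact hg w k hk
    · intro w
      rw [mul_zero, map_zero]
    · intro x y _ _ hx hy w
      rw [mul_add, map_add, hx, hy, add_zero]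
    · intro t x _ hx w
      rw [smul_eq_mul, ← mul_assoc, hx])) ∘ₗ
    (Submodule.Quotient.restrictScalarsEquiv F (fockIdeal F Z)).symm.toLinearMap

theorem lift_mk {M : Type*} [AddCommGroup M] [Module F M] (g : FermionAlg F Z →ₗ[F] M)
    (hg : ∀ u k, 0 < 2 * k + Z.shift → g (u * fermion F Z k) = 0) (u : FermionAlg F Z) :
    lift g hg (mk F Z u) = g u := rfl

theorem mk_surjective : Surjective (mk F Z) := Submodule.mkQ_surjective _

theorem mode_mk (k : ℤ) (u : FermionAlg F Z) :
    mode F Z k (mk F Z u) = mk F Z (fermion F Z k * u) := rfl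

/-- Algebra maps out of the fermion algebra. -/
def liftAlg {A : Type*} [Ring A] [Algebra F A] (g : ℤ → A)
    (hg : ∀ k l, g k * g l + g l * g k = if k + l + Z.shift = 0 then 1 else 0) :
    FermionAlg F Z →ₐ[F] A :=
  RingQuot.liftAlgHom F ⟨FreeAlgebra.lift F g, by
    rintro _ _ ⟨k, l⟩
    have := hg k l
    split_ifs at this ⊢ <;> simpa using this⟩

theorem liftAlg_fermion {A : Type*} [Ring A] [Algebra F A] (g : ℤ → A)
    (hg : ∀ k l, g k * g l + g l * g k = if k + l + Z.shift = 0 then 1 else 0) (k : ℤ) :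
    liftAlg (F := F) (Z := Z) g hg (fermion F Z k) = g k := by
  have := RingQuot.liftAlgHom_mkAlgHom_apply F (FreeAlgebra.lift F g) (s := FermionRel F Z) (by
    rintro _ _ ⟨k, l⟩
    have := hg k l
    split_ifs at this ⊢ <;> simpa using this) (FreeAlgebra.ι F k)
  rw [FreeAlgebra.lift_ι_apply] at this
  exact this

/-! ### The exterior algebra model, the vacuum functional and parity -/

/-- The contraction with a coordinate on the exterior algebra. -/
def exteriorContract (F : Type*) [Field F] (k : ℤ) :
    Module.End F (ExteriorAlgebra F (ℤ →₀ F)) :=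
  CliffordAlgebra.contractLeft (Q := (0 : QuadraticForm F (ℤ →₀ F)))
    (Finsupp.lapply k : Module.Dual F (ℤ →₀ F))

theorem exteriorContract_one (k : ℤ) : exteriorContract F k 1 = 0 :=
  CliffordAlgebra.contractLeft_one _ _

theorem exteriorContract_ι_mul (k l : ℤ) (x : ExteriorAlgebra F (ℤ →₀ F)) :
    exteriorContract F k (ExteriorAlgebra.ι F (Finsupp.single l (1 : F)) * x) =
      (if k = l then (1 : F) else 0) • x -
        ExteriorAlgebra.ι F (Finsupp.single l (1 : F)) * exteriorContract F k x := by
  refine (CliffordAlgebra.contractLeft_ι_mul _ _ _).trans ?_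
  rw [Finsupp.lapply_apply, Finsupp.single_apply]
  simp only [eq_comm]
  rfl

theorem exteriorContract_comm (k l : ℤ) (x : ExteriorAlgebra F (ℤ →₀ F)) :
    exteriorContract F k (exteriorContract F l x) =
      - exteriorContract F l (exteriorContract F k x) :=
  CliffordAlgebra.contractLeft_comm _ _ _

/-- The operators of the modes on the exterior algebra. -/
def exteriorMode (F : Type*) [Field F] (σ k : ℤ) :
    Module.End F (ExteriorAlgebra F (ℤ →₀ F)) :=
  (if 2 * k + σ ≤ 0 then (1 : F) else 0) •
      LinearMap.mulLeft F (ExteriorAlgebra.ι F (Finsupp.single k (1 : F))) +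
    modeStep F σ k • exteriorContract F (-k - σ)

/-- Multiplication by `e_l` and contraction with the `k`-th coordinate satisfy the canonical
anticommutation relations. The zero mode of the integer sector is `e_0` plus half its contraction,
so that its square is `1/2`. -/
theorem exteriorMode_anticomm (h2 : (2 : F) ≠ 0) (σ k l : ℤ) :
    exteriorMode F σ k * exteriorMode F σ l + exteriorMode F σ l * exteriorMode F σ k =
      if k + l + σ = 0 then 1 else 0 := by
  refine LinearMap.ext fun x => ?_
  have hι : ∀ k l : ℤ, ExteriorAlgebra.ι F (Finsupp.single k (1 : F)) *
      (ExteriorAlgebra.ι F (Finsupp.single l (1 : F)) * x) =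
      - (ExteriorAlgebra.ι F (Finsupp.single l (1 : F)) *
        (ExteriorAlgebra.ι F (Finsupp.single k (1 : F)) * x)) := by
    intro k l
    rw [eq_neg_iff_add_eq_zero, ← mul_assoc, ← mul_assoc, ← add_mul,
      ExteriorAlgebra.ι_add_mul_swap, zero_mul]
  have hδ : ∀ k l : ℤ, (if -k - σ = l then (1 : F) else 0) = if k + l + σ = 0 then 1 else 0 := by
    intro k l
    by_cases h : k + l + σ = 0
    · rw [if_pos h, if_pos (by omega)]
    · rw [if_neg h, if_neg (by omega)]
  simp only [exteriorMode, LinearMap.add_apply, Module.End.mul_apply, LinearMap.smul_apply,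
    LinearMap.mulLeft_apply, mul_add, mul_smul_comm]
  rw [exteriorContract_ι_mul, exteriorContract_ι_mul, hδ, hδ, hι l k,
    exteriorContract_comm (-l - σ), show l + k + σ = k + l + σ by ring]
  by_cases h : k + l + σ = 0
  · simp only [if_pos h, Module.End.one_apply]
    -- For opposite modes exactly one of the two products contributes, except for the zero mode,
    -- where each contributes one half.
    have h1 : (if 2 * k + σ ≤ 0 then (1 : F) else 0) * modeStep F σ l +
        (if 2 * l + σ ≤ 0 then (1 : F) else 0) * modeStep F σ k = 1 := by
      obtain rfl : l = -k - σ := by omega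
      unfold modeStep
      rcases lt_trichotomy (2 * k + σ) 0 with h | h | h
      · simp [show 2 * k + σ ≤ 0 by omega, show 0 < 2 * (-k - σ) + σ by omega,
          show ¬ 0 < 2 * k + σ by omega, h.ne]
      · simp only [show 2 * (-k - σ) + σ = 0 by omega, h, lt_irrefl, le_refl, if_true, if_false]
        rw [one_mul, ← two_mul, mul_one_div_cancel h2]
      · simp [show ¬ 2 * k + σ ≤ 0 by omega, show 2 * (-k - σ) + σ ≤ 0 by omega, h]
    conv_rhs => rw [← one_smul F x, ← h1]
    module
  · simp only [if_neg h, LinearMap.zero_apply]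
    module

/-- There is a linear functional on the Fock space that takes the value `1` at the vacuum and
vanishes on the images of the creation operators. -/
theorem exists_vacuum_functional (h2 : (2 : F) ≠ 0) : ∃ ℓ : Fock F Z →ₗ[F] F,
    ℓ (vac F Z) = 1 ∧ ∀ k, 2 * k + Z.shift < 0 → ∀ v, ℓ (mode F Z k v) = 0 := by
  let ρ := liftAlg (F := F) (Z := Z) (exteriorMode F Z.shift) (exteriorMode_anticomm h2 Z.shift)
  let g : FermionAlg F Z →ₗ[F] F :=
    -- The functional is the degree zero component of `u` applied to `1` in the exterior algebra.
    (ExteriorAlgebra.algebraMapInv (R := F) (M := ℤ →₀ F)).toLinearMap ∘ₗ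
      (LinearMap.applyₗ (1 : ExteriorAlgebra F (ℤ →₀ F))) ∘ₗ ρ.toLinearMap
  have hg : ∀ u, g u = ExteriorAlgebra.algebraMapInv (ρ u 1) := fun u => rfl
  refine ⟨lift g fun u k hk => ?_, ?_, fun k hk v => ?_⟩
  · have : ρ (fermion F Z k) 1 = 0 := by
      rw [liftAlg_fermion, exteriorMode, if_neg (by omega), zero_smul, zero_add,
        LinearMap.smul_apply, exteriorContract_one, smul_zero]
    rw [hg, map_mul, Module.End.mul_apply, this, map_zero, map_zero]
  · rw [vac, lift_mk, hg, map_one ρ, Module.End.one_apply, map_one]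
  · obtain ⟨u, rfl⟩ := mk_surjective v
    rw [mode_mk, lift_mk, hg, map_mul, Module.End.mul_apply, liftAlg_fermion, exteriorMode,
      if_pos (by omega), modeStep, if_neg (by omega), if_neg (by omega), zero_smul, add_zero,
      one_smul, LinearMap.mulLeft_apply, map_mul]
    have : ExteriorAlgebra.algebraMapInv (ExteriorAlgebra.ι F (Finsupp.single k (1 : F))) = 0 := by
      simp [ExteriorAlgebra.algebraMapInv]
    rw [this, zero_mul]

/-- The involution of the Fock space that changes the sign of all modes. -/
theorem exists_parity : ∃ τ : Fock F Z →ₗ[F] Fock F Z,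
    τ (vac F Z) = vac F Z ∧ ∀ k v, τ (mode F Z k v) = - mode F Z k (τ v) := by
  let α := liftAlg (F := F) (Z := Z) (fun k => - fermion F Z k) fun k l => by
    rw [neg_mul_neg, neg_mul_neg, fermion_anticomm]
  let g : FermionAlg F Z →ₗ[F] Fock F Z := ((mk F Z).restrictScalars F) ∘ₗ α.toLinearMap
  have hg : ∀ u, g u = mk F Z (α u) := fun u => rfl
  refine ⟨lift g fun u k hk => ?_, ?_, fun k v => ?_⟩
  · have := mode_vac (F := F) (Z := Z) hk
    rw [vac, mode_mk, mul_one] at this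
    rw [hg, map_mul, liftAlg_fermion, mul_neg, map_neg, ← smul_eq_mul, map_smul, this, smul_zero,
      neg_zero]
  · exact (lift_mk g _ 1).trans ((hg 1).trans (congrArg (mk F Z) (map_one α)))
  · obtain ⟨u, rfl⟩ := mk_surjective v
    rw [mode_mk, lift_mk, lift_mk, hg, map_mul, liftAlg_fermion, neg_mul, map_neg, hg, mode_mk]

theorem word_cons (k : ℤ) (l : List ℤ) : word F Z (k :: l) = mode F Z k (word F Z l) := rfl

theorem vac_mem_part : vac F Z ∈ part F Z 0 := Submodule.subset_span ⟨[], by simp, rfl⟩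

/-- The two parity parts lie in the eigenspaces `1` and `-1` of the parity involution, which meet
trivially because `2 ≠ 0`. -/
theorem part_disjoint (h2 : (2 : F) ≠ 0) {s : ZMod 2} {v : Fock F Z} (h : v ∈ part F Z s)
    (h' : v ∈ part F Z (s + 1)) : v = 0 := by
  obtain ⟨τ, hvac, hmode⟩ := exists_parity (F := F) (Z := Z)
  have hword : ∀ l : List ℤ, τ (word F Z l) = (-1 : F) ^ l.length • word F Z l := by
    intro l
    induction l with
    | nil => simpa [word] using hvac
    | cons k l ih => rw [word_cons, hmode, ih, map_smul, List.length_cons, pow_succ]; module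
  have h0 : ∀ v ∈ part F Z 0, τ v = v := by
    intro v hv
    induction hv using Submodule.span_induction with
    | mem v hv =>
      obtain ⟨l, hl, rfl⟩ := hv
      have : Even l.length := (ZMod.natCast_eq_zero_iff_even).1 hl
      rw [hword, this.neg_one_pow, one_smul]
    | zero => exact map_zero _
    | add v w _ _ hv hw => rw [map_add, hv, hw]
    | smul t v _ hv => rw [map_smul, hv]
  have h1 : ∀ v ∈ part F Z 1, τ v = -v := by
    intro v hv
    induction hv using Submodule.span_induction with
    | mem v hv =>
      obtain ⟨l, hl, rfl⟩ := hv
      have : Odd l.length := (ZMod.natCast_eq_one_iff_odd).1 hl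
      rw [hword, this.neg_one_pow, neg_one_smul]
    | zero => rw [map_zero, neg_zero]
    | add v w _ _ hv hw => rw [map_add, hv, hw]; abel
    | smul t v _ hv => rw [map_smul, hv, smul_neg]
  have key : ∀ v, v ∈ part F Z 0 → v ∈ part F Z 1 → v = 0 := by
    intro v hv hv'
    have := (h0 v hv).symm.trans (h1 v hv')
    rw [eq_neg_iff_add_eq_zero, ← two_smul F] at this
    exact (smul_eq_zero.1 this).resolve_left h2
  rcases (by decide : ∀ s : ZMod 2, s = 0 ∨ s = 1) s with rfl | rfl
  · exact key v h (by simpa using h')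
  · exact key v h' h

/-! ### Vectors killed by all annihilation operators -/

theorem shift_eq (Z : Sector) : Z.shift = 0 ∨ Z.shift = 1 := by
  cases Z <;> simp [Sector.shift]

/-- The zero mode vectors and the vectors in the images of the modes with index in `S`. -/
def creationSpan (F : Type*) [Field F] (Z : Sector) (S : Finset ℤ) : Submodule F (Fock F Z) :=
  Submodule.span F {vac F Z, mode F Z 0 (vac F Z)} ⊔ ⨆ r ∈ S, LinearMap.range (mode F Z r)

theorem vac_mem_creationSpan (S : Finset ℤ) : vac F Z ∈ creationSpan F Z S :=
  Submodule.mem_sup_left (Submodule.subset_span (by simp))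

theorem mode_zero_vac_mem_creationSpan (S : Finset ℤ) :
    mode F Z 0 (vac F Z) ∈ creationSpan F Z S :=
  Submodule.mem_sup_left (Submodule.subset_span (by simp))

theorem mode_mem_creationSpan {S : Finset ℤ} {r : ℤ} (hr : r ∈ S) (v : Fock F Z) :
    mode F Z r v ∈ creationSpan F Z S :=
  Submodule.mem_sup_right (Submodule.mem_iSup_of_mem r (Submodule.mem_iSup_of_mem hr ⟨v, rfl⟩))

theorem creationSpan_le {S : Finset ℤ} {P : Submodule F (Fock F Z)} (h0 : vac F Z ∈ P)
    (h1 : mode F Z 0 (vac F Z) ∈ P) (h : ∀ r ∈ S, ∀ v, mode F Z r v ∈ P) :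
    creationSpan F Z S ≤ P := by
  refine sup_le (Submodule.span_le.2 ?_) (iSup₂_le fun r hr => ?_)
  · rintro v (rfl | rfl)
    · exact h0
    · exact h1
  · rintro _ ⟨v, rfl⟩
    exact h r hr v

theorem creationSpan_mono {S T : Finset ℤ} (h : S ⊆ T) : creationSpan F Z S ≤ creationSpan F Z T :=
  creationSpan_le (vac_mem_creationSpan T) (mode_zero_vac_mem_creationSpan T)
    fun _ hr => mode_mem_creationSpan (h hr)

/-- The words in creation operators and zero modes span the Fock space. -/
theorem mem_span_creation_words (v : Fock F Z) :
    v ∈ Submodule.span F (word F Z '' {l : List ℤ | ∀ k ∈ l, 2 * k + Z.shift ≤ 0}) := by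
  induction v using fock_induction with
  | hvac => exact Submodule.subset_span ⟨[], by simp, rfl⟩
  | hadd v w hv hw => exact add_mem hv hw
  | hsmul t v hv => exact Submodule.smul_mem _ t hv
  | hmode k v hv =>
    change mode F Z k v ∈ _
    have hcr : ∀ k : ℤ, 2 * k + Z.shift ≤ 0 → ∀ v ∈ Submodule.span F
        (word F Z '' {l : List ℤ | ∀ k ∈ l, 2 * k + Z.shift ≤ 0}), mode F Z k v ∈
        Submodule.span F (word F Z '' {l : List ℤ | ∀ k ∈ l, 2 * k + Z.shift ≤ 0}) := by
      intro k hk v hv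
      induction hv using Submodule.span_induction with
      | mem v hv =>
        obtain ⟨l, hl, rfl⟩ := hv
        exact Submodule.subset_span ⟨k :: l, List.forall_mem_cons.2 ⟨hk, hl⟩, rfl⟩
      | zero => rw [map_zero]; exact zero_mem _
      | add v w _ _ hv hw => rw [map_add]; exact add_mem hv hw
      | smul t v _ hv => rw [map_smul]; exact Submodule.smul_mem _ t hv
    by_cases hk : 2 * k + Z.shift ≤ 0
    · exact hcr k hk v hv
    induction hv using Submodule.span_induction with
    | mem v hv =>
      obtain ⟨l, hl, rfl⟩ := hv
      induction l with
      | nil =>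
        change mode F Z k (vac F Z) ∈ _
        rw [mode_vac (by omega)]
        exact zero_mem _
      | cons r l ih =>
        have hl' : (2 * r + Z.shift ≤ 0) ∧ ∀ k ∈ l, 2 * k + Z.shift ≤ 0 :=
          List.forall_mem_cons.1 hl
        rw [word_cons, mode_mode]
        refine sub_mem ?_ (hcr r hl'.1 _ (ih hl'.2))
        split_ifs
        · exact Submodule.subset_span ⟨l, hl'.2, rfl⟩
        · exact zero_mem _
    | zero => rw [map_zero]; exact zero_mem _
    | add v w _ _ hv hw => rw [map_add]; exact add_mem hv hw
    | smul t v _ hv => rw [map_smul]; exact Submodule.smul_mem _ t hv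

/-- The square of `a(0)` is `1/2`, and `a(0)` anticommutes with every strictly negative mode. -/
theorem mode_zero_mem_creationSpan (h2 : (2 : F) ≠ 0) (hZ : Z.shift = 0) {S : Finset ℤ}
    (hS : ∀ r ∈ S, 2 * r + Z.shift < 0) {v : Fock F Z} (hv : v ∈ creationSpan F Z S) :
    mode F Z 0 v ∈ creationSpan F Z S := by
  have : creationSpan F Z S ≤ (creationSpan F Z S).comap (mode F Z 0) := by
    refine creationSpan_le (mode_zero_vac_mem_creationSpan S) ?_ fun r hr v => ?_
    · rw [Submodule.mem_comap]
      have h := (cliffordModes (F := F) (Z := Z)).anticomm 0 0 (vac F Z)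
      rw [if_pos (by omega), ← two_smul F] at h
      rw [← one_smul F (mode F Z 0 _), ← inv_mul_cancel₀ h2, mul_smul, h]
      exact Submodule.smul_mem _ _ (vac_mem_creationSpan S)
    · rw [Submodule.mem_comap, mode_mode_of_ne (by have := hS r hr; omega)]
      exact neg_mem (mode_mem_creationSpan hr _)
  exact this hv

theorem exists_mem_creationSpan (h2 : (2 : F) ≠ 0) (v : Fock F Z) :
    ∃ S : Finset ℤ, (∀ r ∈ S, 2 * r + Z.shift < 0) ∧ v ∈ creationSpan F Z S := by
  induction mem_span_creation_words v using Submodule.span_induction with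
  | mem v hv =>
    obtain ⟨l, hl, rfl⟩ := hv
    induction l with
    | nil => exact ⟨∅, by simp, vac_mem_creationSpan ∅⟩
    | cons r l ih =>
      have hl' : (2 * r + Z.shift ≤ 0) ∧ ∀ k ∈ l, 2 * k + Z.shift ≤ 0 :=
        List.forall_mem_cons.1 hl
      obtain ⟨S, hS, hmem⟩ := ih hl'.2
      rw [word_cons]
      by_cases hr : 2 * r + Z.shift < 0
      · exact ⟨{r}, by simpa using hr, mode_mem_creationSpan (by simp) _⟩
      · have hσ := shift_eq Z
        obtain ⟨rfl, hZ⟩ : r = 0 ∧ Z.shift = 0 := by omega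
        exact ⟨S, hS, mode_zero_mem_creationSpan h2 hZ hS hmem⟩
  | zero => exact ⟨∅, by simp, zero_mem _⟩
  | add v w _ _ hv hw =>
    obtain ⟨S, hS, hv⟩ := hv
    obtain ⟨T, hT, hw⟩ := hw
    refine ⟨S ∪ T, fun r hr => ?_, add_mem (creationSpan_mono Finset.subset_union_left hv)
      (creationSpan_mono Finset.subset_union_right hw)⟩
    rcases Finset.mem_union.1 hr with h | h
    · exact hS r h
    · exact hT r h
  | smul t v _ hv =>
    obtain ⟨S, hS, hv⟩ := hv
    exact ⟨S, hS, Submodule.smul_mem _ t hv⟩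

/-- A vector killed by all annihilation operators is a combination of zero mode vectors. -/
theorem mem_span_of_annihilated (h2 : (2 : F) ≠ 0) {v : Fock F Z}
    (hv : ∀ k, 0 < 2 * k + Z.shift → mode F Z k v = 0) :
    ∃ α β : F, v = α • vac F Z + β • mode F Z 0 (vac F Z) := by
  obtain ⟨S, hS, hmem⟩ := exists_mem_creationSpan h2 v
  have key : v ∈ creationSpan F Z ∅ := by
    induction S using Finset.induction_on with
    | empty => exact hmem
    | insert r S hrS ih =>
      refine ih (fun r hr => hS r (Finset.mem_insert_of_mem hr)) ?_
      have hr : 2 * r + Z.shift < 0 := hS r (Finset.mem_insert_self r S)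
      have hσ := shift_eq Z
      -- The operator `a(-r) a(r)`, in true mode labels, fixes vectors killed by `a(-r)`,
      -- annihilates the image of `a(r)` and preserves the images of the other modes in `S`.
      -- Applying it to `v` removes `r` from `S`.
      have hfix : ∀ w : Fock F Z, mode F Z (-r - Z.shift) w = 0 →
          mode F Z (-r - Z.shift) (mode F Z r w) = w := fun w hw => by
        rw [mode_mode, if_pos (by omega), hw, map_zero, sub_zero]
      have hle : creationSpan F Z (insert r S) ≤
          (creationSpan F Z S).comap (mode F Z (-r - Z.shift) ∘ₗ mode F Z r) := by
        refine creationSpan_le ?_ ?_ fun q hq w => ?_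
        · rw [Submodule.mem_comap, LinearMap.comp_apply, hfix _ (mode_vac (by omega))]
          exact vac_mem_creationSpan S
        · rw [Submodule.mem_comap, LinearMap.comp_apply, hfix]
          · exact mode_zero_vac_mem_creationSpan S
          · rw [mode_mode_of_ne (by omega), mode_vac (by omega), map_zero, neg_zero]
        · rw [Submodule.mem_comap, LinearMap.comp_apply]
          by_cases hqr : q = r
          · rw [hqr, mode_self h2 (by omega), map_zero]
            exact zero_mem _
          · have hqS := (Finset.mem_insert.1 hq).resolve_left hqr
            have hq' := hS q hq
            rw [mode_mode_of_ne (k := r) (by omega), map_neg,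
              mode_mode_of_ne (l := q) (by omega), neg_neg]
            exact mode_mem_creationSpan hqS _
      have := hle hmem
      rwa [Submodule.mem_comap, LinearMap.comp_apply, hfix v (hv _ (by omega))] at this
  simp only [creationSpan, Finset.notMem_empty, iSup_false, iSup_bot, sup_bot_eq] at key
  obtain ⟨α, β, h⟩ := Submodule.mem_span_pair.1 key
  exact ⟨α, β, h.symm⟩

/-- Moving an annihilation operator to the vacuum, it either pairs off with a letter, losing it, or
dies; so annihilation strictly shortens words and must terminate. -/
theorem mode_mem_span_words {k : ℤ} (hk : 0 < 2 * k + Z.shift) {n : ℕ} {v : Fock F Z}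
    (hv : v ∈ Submodule.span F (word F Z '' {l : List ℤ | l.length ≤ n + 1})) :
    mode F Z k v ∈ Submodule.span F (word F Z '' {l : List ℤ | l.length ≤ n}) := by
  have hcr : ∀ (n : ℕ) (k : ℤ), ∀ v ∈ Submodule.span F (word F Z '' {l : List ℤ | l.length ≤ n}),
      mode F Z k v ∈ Submodule.span F (word F Z '' {l : List ℤ | l.length ≤ n + 1}) := by
    intro n k v hv
    induction hv using Submodule.span_induction with
    | mem v hv =>
      obtain ⟨l, hl, rfl⟩ := hv
      have hl' : l.length ≤ n := hl
      exact Submodule.subset_span ⟨k :: l, by simpa using hl', rfl⟩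
    | zero => rw [map_zero]; exact zero_mem _
    | add v w _ _ hv hw => rw [map_add]; exact add_mem hv hw
    | smul t v _ hv => rw [map_smul]; exact Submodule.smul_mem _ t hv
  induction hv using Submodule.span_induction with
  | mem v hv =>
    obtain ⟨l, hl, rfl⟩ := hv
    induction l generalizing n with
    | nil =>
      change mode F Z k (vac F Z) ∈ _
      rw [mode_vac hk]
      exact zero_mem _
    | cons r l ih =>
      have hl' : l.length ≤ n := by simpa using hl
      rw [word_cons, mode_mode]
      refine sub_mem ?_ ?_
      · split_ifs
        · exact Submodule.subset_span ⟨l, hl', rfl⟩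
        · exact zero_mem _
      · cases n with
        | zero =>
          obtain rfl : l = [] := List.length_eq_zero_iff.1 (by omega)
          change mode F Z r (mode F Z k (vac F Z)) ∈ _
          rw [mode_vac hk, map_zero]
          exact zero_mem _
        | succ n => exact hcr n r _ (ih hl')
  | zero => rw [map_zero]; exact zero_mem _
  | add v w _ _ hv hw => rw [map_add]; exact add_mem hv hw
  | smul t v _ hv => rw [map_smul]; exact Submodule.smul_mem _ t hv

theorem exists_mem_span_words (v : Fock F Z) :
    ∃ n, v ∈ Submodule.span F (word F Z '' {l : List ℤ | l.length ≤ n}) := by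
  induction mem_span_creation_words v using Submodule.span_induction with
  | mem v hv =>
    obtain ⟨l, -, rfl⟩ := hv
    exact ⟨l.length, Submodule.subset_span ⟨l, le_refl l.length, rfl⟩⟩
  | zero => exact ⟨0, zero_mem _⟩
  | add v w _ _ hv hw =>
    obtain ⟨n, hn⟩ := hv
    obtain ⟨m, hm⟩ := hw
    have hmono : ∀ {i j : ℕ}, i ≤ j → Submodule.span F (word F Z '' {l : List ℤ | l.length ≤ i}) ≤
        Submodule.span F (word F Z '' {l : List ℤ | l.length ≤ j}) := fun h =>
      Submodule.span_mono (Set.image_mono fun l (hl : l.length ≤ _) => hl.trans h)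
    exact ⟨max n m, add_mem (hmono (le_max_left _ _) hn) (hmono (le_max_right _ _) hm)⟩
  | smul t v _ hv =>
    obtain ⟨n, hn⟩ := hv
    exact ⟨n, Submodule.smul_mem _ t hn⟩

/-- A nonzero subspace stable under all modes contains a nonzero vector killed by the
annihilation operators. -/
theorem exists_annihilated {P : Submodule F (Fock F Z)} (hP : ∀ k, ∀ v ∈ P, mode F Z k v ∈ P)
    {v : Fock F Z} (hv : v ∈ P) (hv0 : v ≠ 0) :
    ∃ w ∈ P, w ≠ 0 ∧ ∀ k, 0 < 2 * k + Z.shift → mode F Z k w = 0 := by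
  obtain ⟨n, hn⟩ := exists_mem_span_words v
  induction n generalizing v with
  | zero =>
    refine ⟨v, hv, hv0, fun k hk => ?_⟩
    have hle : Submodule.span F (word F Z '' {l : List ℤ | l.length ≤ 0}) ≤
        LinearMap.ker (mode F Z k) := by
      rw [Submodule.span_le]
      rintro _ ⟨l, hl, rfl⟩
      obtain rfl : l = [] := List.length_eq_zero_iff.1 (Nat.le_zero.1 hl)
      exact mode_vac hk
    exact hle hn
  | succ n ih =>
    by_cases h : ∀ k, 0 < 2 * k + Z.shift → mode F Z k v = 0
    · exact ⟨v, hv, hv0, h⟩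
    · push Not at h
      obtain ⟨k, hk, hne⟩ := h
      exact ih (hP k v hv) hne (mode_mem_span_words hk hn)

/-! ### Irreducibility under products of two modes -/

/-- The parity parts are irreducible under products of two modes. -/
theorem eq_part_of_stable (h2 : (2 : F) ≠ 0) {s : ZMod 2} {N : Submodule F (Fock F Z)}
    (hN : ∀ r t, ∀ v ∈ N, mode F Z r (mode F Z t v) ∈ N) (hle : N ≤ part F Z s) (hne : N ≠ ⊥) :
    N = part F Z s := by
  -- `O` is the companion of `N` of opposite parity; `N ⊔ O` is stable under single modes.
  let O : Submodule F (Fock F Z) := ⨆ k, N.map (mode F Z k)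
  have hO : ∀ k, ∀ v ∈ O, mode F Z k v ∈ N := by
    intro k
    have : O ≤ N.comap (mode F Z k) := by
      refine iSup_le fun l => ?_
      rintro _ ⟨v, hv, rfl⟩
      exact hN k l v hv
    exact fun v hv => this hv
  have hNO : ∀ k, ∀ v ∈ N, mode F Z k v ∈ O := fun k v hv =>
    Submodule.mem_iSup_of_mem k ⟨v, hv, rfl⟩
  have hOle : O ≤ part F Z (s + 1) := by
    refine iSup_le fun k => ?_
    rintro _ ⟨v, hv, rfl⟩
    exact fermion_mem_part F Z k s (hle hv)
  have hstab : ∀ k, ∀ v ∈ N ⊔ O, mode F Z k v ∈ N ⊔ O := by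
    intro k v hv
    obtain ⟨x, hx, y, hy, rfl⟩ := Submodule.mem_sup.1 hv
    rw [map_add]
    exact add_mem (Submodule.mem_sup_right (hNO k x hx)) (Submodule.mem_sup_left (hO k y hy))
  have hvacmem : vac F Z ∈ N ⊔ O := by
    obtain ⟨v, hv, hv0⟩ := Submodule.exists_mem_ne_zero_of_ne_bot hne
    obtain ⟨w, hw, hw0, hann⟩ := exists_annihilated hstab (Submodule.mem_sup_left hv) hv0
    obtain ⟨α, β, rfl⟩ := mem_span_of_annihilated h2 hann
    have hα : α • vac F Z ∈ part F Z 0 := Submodule.smul_mem _ α vac_mem_part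
    have hβ : β • mode F Z 0 (vac F Z) ∈ part F Z 1 :=
      Submodule.smul_mem _ β (fermion_mem_part F Z 0 0 vac_mem_part)
    -- `N` and `O` have opposite parity, so the even and odd components of a vector of `N ⊔ O` lie
    -- in it separately.
    have hcomp : α • vac F Z ∈ N ⊔ O ∧ β • mode F Z 0 (vac F Z) ∈ N ⊔ O := by
      suffices h : α • vac F Z ∈ N ⊔ O by
        exact ⟨h, by simpa using sub_mem hw h⟩
      obtain ⟨x, hx, y, hy, hxy⟩ := Submodule.mem_sup.1 hw
      rcases (by decide : ∀ s : ZMod 2, s = 0 ∨ s = 1) s with rfl | rfl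
      · have h1 : x - α • vac F Z = β • mode F Z 0 (vac F Z) - y := by
          rw [sub_eq_sub_iff_add_eq_add, hxy, add_comm]
        have h0 := part_disjoint h2 (sub_mem (hle hx) hα)
          (h1 ▸ sub_mem hβ (hOle hy))
        rw [← sub_eq_zero.1 h0]
        exact Submodule.mem_sup_left hx
      · have h1 : y - α • vac F Z = β • mode F Z 0 (vac F Z) - x := by
          rw [sub_eq_sub_iff_add_eq_add, add_comm y, hxy, add_comm]
        have h0 := part_disjoint (s := 0) h2 (sub_mem (hOle hy) hα)
          (h1 ▸ sub_mem hβ (hle hx))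
        rw [← sub_eq_zero.1 h0]
        exact Submodule.mem_sup_right hy
    by_cases hα0 : α = 0
    · have hβ0 : β ≠ 0 := by
        rintro rfl
        exact hw0 (by simp [hα0])
      have hm : mode F Z 0 (vac F Z) ∈ N ⊔ O := by
        simpa [smul_smul, hβ0] using Submodule.smul_mem _ β⁻¹ hcomp.2
      -- In the integer sector `2 a(0)² = 1` recovers the vacuum. In the half-integer sector index
      -- `0` is the mode `1/2`, which kills the vacuum, so `w` would be zero.
      rcases shift_eq Z with hZ | hZ
      · have h := (cliffordModes (F := F) (Z := Z)).anticomm 0 0 (vac F Z)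
        rw [if_pos (by omega)] at h
        rw [← h]
        exact add_mem (hstab 0 _ hm) (hstab 0 _ hm)
      · exact absurd (by rw [hα0, mode_vac (by omega)]; simp) hw0
    · simpa [smul_smul, hα0] using Submodule.smul_mem _ α⁻¹ hcomp.1
  have htop : ∀ v, v ∈ N ⊔ O := fun v => by
    induction v using fock_induction with
    | hvac => exact hvacmem
    | hadd v w hv hw => exact add_mem hv hw
    | hsmul t v hv => exact Submodule.smul_mem _ t hv
    | hmode k v hv => exact hstab k v hv
  refine le_antisymm hle fun v hv => ?_
  obtain ⟨x, hx, y, hy, rfl⟩ := Submodule.mem_sup.1 (htop v)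
  have hy' : y ∈ part F Z s := by
    simpa using sub_mem hv (hle hx)
  rw [part_disjoint h2 hy' (hOle hy), add_zero]
  exact hx

end Fock

end FockStructure

/-! ### The Virasoro relations on the Fock space -/

section FockVirasoro

open Function

namespace Fock

variable {F : Type*} [Field F] {Z : Sector}

theorem normalOrd_smul_of_le {k l : ℤ} (h : k ≤ l) (v : Fock F Z) :
    normalOrd F Z k l • v = mode F Z k (mode F Z l v) := by
  rw [normalOrd, if_pos h, mul_smul]; rfl

theorem normalOrd_smul_of_lt {k l : ℤ} (h : l < k) (v : Fock F Z) :
    normalOrd F Z k l • v = - mode F Z l (mode F Z k v) := by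
  rw [normalOrd, if_neg (not_le.2 h), neg_smul, mul_smul]; rfl

theorem coeff_eq_zero {l : ℤ} (h : 2 * l + Z.shift = 0) : (l : F) + (Z.shift : F) / 2 = 0 := by
  have hσ := shift_eq Z
  obtain ⟨rfl, hZ⟩ : l = 0 ∧ Z.shift = 0 := by omega
  simp [hZ]

theorem correction_of_ne {n : ℤ} (hn : n ≠ 0) : correction F Z n = 0 := by
  cases Z <;> simp [correction, hn]

/-! ### Vacuum expectation values of Virasoro operators -/

theorem virOp_vac {n : ℤ} (hn : 0 ≤ n) :
    virOp F Z n (vac F Z) = correction F Z n • vac F Z := by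
  rw [virOp_apply, finsum_eq_zero_of_forall_eq_zero, smul_zero, add_zero]
  intro l
  rw [summand_smul]
  by_cases hl : -l - Z.shift ≤ n + l
  · rw [normalOrd_smul_of_le hl]
    by_cases h0 : 0 < 2 * (n + l) + Z.shift
    · rw [mode_vac h0, map_zero, smul_zero]
    · rw [coeff_eq_zero (by omega), zero_smul]
  · rw [normalOrd_smul_of_lt (by omega), mode_vac (by omega), map_zero, neg_zero, smul_zero]

/-- Dual to `virOp_vac`: for `n ≤ 0` the left factor of each normal ordered term is a creation
operator, or else its coefficient is zero. -/
theorem functional_virOp {ℓ : Fock F Z →ₗ[F] F}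
    (hℓ : ∀ k, 2 * k + Z.shift < 0 → ∀ v, ℓ (mode F Z k v) = 0) {n : ℤ} (hn : n ≤ 0)
    (v : Fock F Z) : ℓ (virOp F Z n v) = correction F Z n * ℓ v := by
  rw [virOp_apply, map_add, map_smul, map_smul, map_finsum ℓ (summand_finite F Z n v),
    finsum_eq_zero_of_forall_eq_zero, smul_zero, add_zero, smul_eq_mul]
  intro l
  rw [summand_smul, map_smul]
  by_cases hl : -l - Z.shift ≤ n + l
  · rw [normalOrd_smul_of_le hl]
    by_cases h0 : 2 * (-l - Z.shift) + Z.shift < 0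
    · rw [hℓ _ h0, smul_zero]
    · rw [coeff_eq_zero (by omega), zero_smul]
  · rw [normalOrd_smul_of_lt (by omega), map_neg, hℓ _ (by omega), neg_zero, smul_zero]

/-- This is why the contraction takes the value `1/2` at the zero mode: it is the two-point function
of the vacuum. -/
theorem functional_mode_mode_vac (h2 : (2 : F) ≠ 0) {ℓ : Fock F Z →ₗ[F] F}
    (h1 : ℓ (vac F Z) = 1) (hℓ : ∀ k, 2 * k + Z.shift < 0 → ∀ v, ℓ (mode F Z k v) = 0)
    (x y : ℤ) : ℓ (mode F Z x (mode F Z y (vac F Z))) = contraction F Z.shift x y := by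
  rw [contraction, modeStep]
  rcases lt_trichotomy (2 * x + Z.shift) 0 with h | h | h
  · rw [hℓ x h, if_neg (show ¬ 0 < 2 * x + Z.shift by omega),
      if_neg (show ¬ 2 * x + Z.shift = 0 by omega), ite_self]
  · rw [if_neg (show ¬ 0 < 2 * x + Z.shift by omega), if_pos h]
    split_ifs with hxy
    · obtain rfl : y = x := by omega
      have hs := congrArg ℓ ((cliffordModes (F := F) (Z := Z)).anticomm y y (vac F Z))
      rw [if_pos (by omega), map_add, h1, ← two_mul] at hs
      rw [eq_div_iff h2, mul_comm, hs]
    · rcases lt_or_ge 0 (2 * y + Z.shift) with hy | hy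
      · rw [mode_vac hy, map_zero, map_zero]
      · rw [mode_mode_of_ne hxy, map_neg, hℓ y (by omega), neg_zero]
  · rw [mode_mode, mode_vac h, map_zero, sub_zero, if_pos h]
    split_ifs
    · exact h1
    · exact map_zero ℓ

theorem functional_virOp_mode_mode (h2 : (2 : F) ≠ 0) {ℓ : Fock F Z →ₗ[F] F}
    (h1 : ℓ (vac F Z) = 1) (hℓ : ∀ k, 2 * k + Z.shift < 0 → ∀ v, ℓ (mode F Z k v) = 0)
    {m : ℤ} (hm : 0 < m) (x y : ℤ) :
    ℓ (virOp F Z m (mode F Z x (mode F Z y (vac F Z)))) =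
      -((y : F) + (Z.shift : F) / 2 + (m : F) / 2) * contraction F Z.shift x (m + y) -
        ((x : F) + (Z.shift : F) / 2 + (m : F) / 2) * contraction F Z.shift (m + x) y := by
  rw [virOp_mode h2, virOp_mode h2, virOp_vac hm.le, correction_of_ne hm.ne', zero_smul, map_zero,
    zero_sub, map_neg, map_sub, map_neg, map_smul, map_smul, map_smul,
    functional_mode_mode_vac h2 h1 hℓ, functional_mode_mode_vac h2 h1 hℓ, smul_eq_mul, smul_eq_mul,
    neg_mul]

theorem functional_virOp_virOp (h2 : (2 : F) ≠ 0) {ℓ : Fock F Z →ₗ[F] F}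
    (h1 : ℓ (vac F Z) = 1) (hℓ : ∀ k, 2 * k + Z.shift < 0 → ∀ v, ℓ (mode F Z k v) = 0)
    {m n : ℤ} (hm : 0 < m) (hn : n < 0) :
    ℓ (virOp F Z m (virOp F Z n (vac F Z))) = 1 / 2 * ∑ᶠ l : ℤ,
      ((l : F) + (Z.shift : F) / 2) *
      (-(((n + l : ℤ) : F) + (Z.shift : F) / 2 + (m : F) / 2) *
          contraction F Z.shift (-l - Z.shift) (m + (n + l)) -
        (((-l - Z.shift : ℤ) : F) + (Z.shift : F) / 2 + (m : F) / 2) *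
          contraction F Z.shift (m + (-l - Z.shift)) (n + l)) := by
  rw [virOp_apply n, correction_of_ne hn.ne, zero_smul, zero_add, map_smul, map_smul,
    map_finsum _ (summand_finite F Z n _), map_finsum ℓ, smul_eq_mul]
  · congr 1
    refine finsum_congr fun l => ?_
    rw [summand_smul, normalOrd_smul, if_neg (by omega), sub_zero, map_smul, map_smul,
      functional_virOp_mode_mode h2 h1 hℓ hm, smul_eq_mul]
  · refine Set.Finite.subset (summand_finite F Z n (vac F Z)) fun l hl h => hl ?_
    simp only [h, map_zero]

theorem contraction_sum_half (m : ℕ) : ∑ᶠ l : ℤ,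
    ((l : F) + 1 / 2) * ((l : F) + 1 / 2 - (m : F) / 2) *
      (modeStep F 1 (m - l - 1) - modeStep F 1 (-l - 1)) =
    ∑ i ∈ Finset.range m, ((i : F) + 1 / 2) * ((i : F) + 1 / 2 - (m : F) / 2) := by
  rw [finsum_eq_sum_of_support_subset (s := (Finset.range m).map Nat.castEmbedding),
    Finset.sum_map]
  · refine Finset.sum_congr rfl fun i hi => ?_
    have := Finset.mem_range.1 hi
    rw [modeStep, modeStep, Nat.castEmbedding_apply, if_pos (by omega), if_neg (by omega),
      if_neg (by omega)]
    simp
  · intro l hl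
    simp only [Finset.coe_map, Set.mem_image, Finset.mem_coe, Finset.mem_range,
      Nat.castEmbedding_apply]
    by_contra hne
    refine hl ?_
    have : l < 0 ∨ (m : ℤ) ≤ l := by
      by_contra! h
      exact hne ⟨l.toNat, by omega, by omega⟩
    simp only
    rw [modeStep, modeStep]
    rcases this with h | h
    · rw [if_pos (by omega), if_pos (by omega), sub_self, mul_zero]
    · rw [if_neg (by omega), if_neg (by omega), if_neg (by omega), if_neg (by omega), sub_self,
        mul_zero]

/-- The difference of step functions is `1` strictly between `0` and `m` and `1/2` at both ends; the
end `0` has coefficient zero and the end `m` gives the extra summand. -/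
theorem contraction_sum_int (h2 : (2 : F) ≠ 0) {m : ℕ} (hm : 0 < m) : ∑ᶠ l : ℤ,
    (l : F) * ((l : F) - (m : F) / 2) * (modeStep F 0 (m - l) - modeStep F 0 (-l)) =
    ∑ i ∈ Finset.range m, (i : F) * ((i : F) - (m : F) / 2) + (m : F) * (m / 2) * (1 / 2) := by
  rw [finsum_eq_sum_of_support_subset (s := (Finset.range (m + 1)).map Nat.castEmbedding),
    Finset.sum_map, Finset.sum_range_succ]
  · congr 1
    · refine Finset.sum_congr rfl fun i hi => ?_
      have := Finset.mem_range.1 hi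
      rcases Nat.eq_zero_or_pos i with rfl | hi0
      · simp
      rw [modeStep, modeStep, Nat.castEmbedding_apply, if_pos (by omega), if_neg (by omega),
        if_neg (by omega)]
      simp
    · rw [modeStep, modeStep, Nat.castEmbedding_apply, if_neg (by omega), if_pos (by omega),
        if_neg (by omega), if_neg (by omega)]
      simp only [Int.cast_natCast]
      field_simp
      ring
  · intro l hl
    simp only [Finset.coe_map, Set.mem_image, Finset.mem_coe, Finset.mem_range,
      Nat.castEmbedding_apply]
    by_contra hne
    refine hl ?_
    have : l < 0 ∨ (m : ℤ) < l := by
      by_contra! h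
      exact hne ⟨l.toNat, by omega, by omega⟩
    simp only
    rw [modeStep, modeStep]
    rcases this with h | h
    · rw [if_pos (by omega), if_pos (by omega), sub_self, mul_zero]
    · rw [if_neg (by omega), if_neg (by omega), if_neg (by omega), if_neg (by omega), sub_self,
        mul_zero]

/-- This sum and the next are evaluated over `ℤ`, where the factor 3 can be cancelled before passing
to `F`, so that characteristic 3 is covered. -/
theorem sum_half_int (m : ℤ) (n : ℕ) :
    3 * ∑ i ∈ Finset.range n, (2 * (i : ℤ) + 1) * (2 * i + 1 - m) =
      n * (4 * n ^ 2 - 1) - 3 * m * n ^ 2 := by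
  induction n with
  | zero => simp
  | succ n ih => rw [Finset.sum_range_succ, mul_add, ih]; push_cast; ring

theorem sum_int_int (m : ℤ) (n : ℕ) :
    6 * ∑ i ∈ Finset.range n, (i : ℤ) * (2 * i - m) =
      2 * n * (n - 1) * (2 * n - 1) - 3 * m * n * (n - 1) := by
  induction n with
  | zero => simp
  | succ n ih => rw [Finset.sum_range_succ, mul_add, ih]; push_cast; ring

/-- The central term comes from the finite window of indices on which the two contractions differ.
In the integer sector there is an excess `m/8 = 2m · 1/16`, which forces the correction `1/16`. -/
theorem functional_virOp_virOp_neg (h2 : (2 : F) ≠ 0) {ℓ : Fock F Z →ₗ[F] F}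
    (h1 : ℓ (vac F Z) = 1) (hℓ : ∀ k, 2 * k + Z.shift < 0 → ∀ v, ℓ (mode F Z k v) = 0)
    {m : ℕ} (hm : 0 < m) : ℓ (virOp F Z m (virOp F Z (-m) (vac F Z))) =
      2 * m * correction F Z 0 + Vir.central F m / 2 := by
  rw [functional_virOp_virOp h2 h1 hℓ (by omega) (by omega)]
  obtain ⟨q, hq⟩ := Vir.six_dvd m
  have hcen : Vir.central F m = (q : F) / 2 := by
    rw [Vir.central, hq, Int.mul_ediv_cancel_left _ (by norm_num)]
  have hterm : ∀ l : ℤ, ((l : F) + (Z.shift : F) / 2) *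
      (-(((-m + l : ℤ) : F) + (Z.shift : F) / 2 + ((m : ℤ) : F) / 2) *
          contraction F Z.shift (-l - Z.shift) (m + (-m + l)) -
        (((-l - Z.shift : ℤ) : F) + (Z.shift : F) / 2 + ((m : ℤ) : F) / 2) *
          contraction F Z.shift (m + (-l - Z.shift)) (-m + l)) =
      ((l : F) + (Z.shift : F) / 2) * ((l : F) + (Z.shift : F) / 2 - (m : F) / 2) *
      (modeStep F Z.shift (m - l - Z.shift) - modeStep F Z.shift (-l - Z.shift)) := by
    intro l
    rw [contraction, contraction, if_pos (by ring), if_pos (by ring),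
      show (m : ℤ) + (-l - Z.shift) = m - l - Z.shift by ring]
    push_cast
    field_simp
    ring
  simp only [hterm]
  rw [hcen]
  cases Z with
  | half =>
    have hs := sum_half_int m m
    have hz : ∑ i ∈ Finset.range m, (2 * (i : ℤ) + 1) * (2 * i + 1 - m) = 2 * q := by
      linarith
    have hF := congrArg (Int.cast : ℤ → F) hz
    push_cast at hF
    have := contraction_sum_half (F := F) m
    simp only [Sector.shift, Int.cast_one, correction] at this ⊢
    rw [this]
    have h4 : ∑ i ∈ Finset.range m, ((i : F) + 1 / 2) * ((i : F) + 1 / 2 - (m : F) / 2) =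
        1 / 4 * ∑ i ∈ Finset.range m, (2 * (i : F) + 1) * (2 * i + 1 - m) := by
      rw [Finset.mul_sum]
      refine Finset.sum_congr rfl fun i _ => ?_
      have : (4 : F) = 2 * 2 := by norm_num
      rw [this]
      field_simp
    rw [h4, hF]
    have : (4 : F) = 2 * 2 := by norm_num
    rw [this]
    field_simp
    ring
  | int =>
    have hs := sum_int_int m m
    have hz : 2 * ∑ i ∈ Finset.range m, (i : ℤ) * (2 * i - m) = m - m ^ 2 + 2 * q := by
      linarith
    have hF := congrArg (Int.cast : ℤ → F) hz
    push_cast at hF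
    have := contraction_sum_int h2 hm
    simp only [Sector.shift, Int.cast_zero, zero_div, add_zero, sub_zero, correction,
      if_true] at this ⊢
    rw [this]
    have h4 : ∑ i ∈ Finset.range m, (i : F) * ((i : F) - (m : F) / 2) =
        1 / 4 * (2 * ∑ i ∈ Finset.range m, (i : F) * (2 * i - m)) := by
      rw [Finset.mul_sum, Finset.mul_sum]
      refine Finset.sum_congr rfl fun i _ => ?_
      have : (4 : F) = 2 * 2 := by norm_num
      rw [this]
      field_simp
    rw [h4, hF]
    have h4 : (4 : F) = 2 * 2 := by norm_num
    have h16 : (16 : F) = 2 * 2 * 2 * 2 := by norm_num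
    rw [h4, h16]
    field_simp
    ring

/-! ### The defect of the Virasoro relation is a scalar -/

/-- The defect of the Virasoro relation for `L(m)` and `L(n)`. -/
def defect (F : Type*) [Field F] (Z : Sector) (m n : ℤ) : Module.End F (Fock F Z) :=
  virOp F Z m * virOp F Z n - virOp F Z n * virOp F Z m - ((m - n : ℤ) : F) • virOp F Z (m + n)

theorem defect_apply (m n : ℤ) (v : Fock F Z) : defect F Z m n v =
    virOp F Z m (virOp F Z n v) - virOp F Z n (virOp F Z m v) -
      ((m - n : ℤ) : F) • virOp F Z (m + n) v := rfl

theorem defect_mode (h2 : (2 : F) ≠ 0) (m n k : ℤ) (v : Fock F Z) :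
    defect F Z m n (mode F Z k v) = mode F Z k (defect F Z m n v) := by
  simp only [defect_apply, virOp_mode h2, map_sub, map_smul]
  rw [show m + (n + k) = m + n + k by ring, show n + (m + k) = m + n + k by ring]
  push_cast
  match_scalars <;> field_simp <;> ring

theorem functional_defect_of_pos (h2 : (2 : F) ≠ 0) {ℓ : Fock F Z →ₗ[F] F}
    (h1 : ℓ (vac F Z) = 1) (hℓ : ∀ k, 2 * k + Z.shift < 0 → ∀ v, ℓ (mode F Z k v) = 0)
    {m n : ℤ} (hm : 0 < m) (hn : n < 0) : ℓ (defect F Z m n (vac F Z)) =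
      (if m + n = 0 then Vir.central F m else 0) * (1 / 2) := by
  rw [defect_apply, virOp_vac hm.le, correction_of_ne hm.ne', zero_smul, map_zero, sub_zero,
    map_sub, map_smul, smul_eq_mul]
  by_cases hmn : m + n = 0
  · obtain rfl : n = -m := by omega
    obtain ⟨m, rfl⟩ := Int.eq_ofNat_of_zero_le hm.le
    rw [functional_virOp_virOp_neg h2 h1 hℓ (by omega), if_pos hmn, hmn,
      functional_virOp hℓ le_rfl, h1]
    push_cast
    ring
  · have h0 : ℓ (virOp F Z (m + n) (vac F Z)) = 0 := by
      rcases le_total 0 (m + n) with h | h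
      · rw [virOp_vac h, correction_of_ne hmn, zero_smul, map_zero]
      · rw [functional_virOp hℓ h, correction_of_ne hmn, zero_mul]
    rw [if_neg hmn, h0, functional_virOp_virOp h2 h1 hℓ hm hn, finsum_eq_zero_of_forall_eq_zero]
    · simp
    · intro l
      rw [contraction, contraction, if_neg (by omega), if_neg (by omega)]
      simp

/-- For indices of the same weak sign each operator acts on the vacuum, or dually on `ℓ`, by its
correction scalar, so the commutator contributes nothing. Opposite signs reduce to
`functional_defect_of_pos` by skew symmetry. -/
theorem functional_defect (h2 : (2 : F) ≠ 0) {ℓ : Fock F Z →ₗ[F] F}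
    (h1 : ℓ (vac F Z) = 1) (hℓ : ∀ k, 2 * k + Z.shift < 0 → ∀ v, ℓ (mode F Z k v) = 0)
    (m n : ℤ) : ℓ (defect F Z m n (vac F Z)) =
      (if m + n = 0 then Vir.central F m else 0) * (1 / 2) := by
  have hsame : (0 ≤ m ∧ 0 ≤ n) ∨ (m ≤ 0 ∧ n ≤ 0) →
      ((m - n : ℤ) : F) * ℓ (virOp F Z (m + n) (vac F Z)) = 0 ∧
        (if m + n = 0 then Vir.central F m else 0) = 0 := by
    intro h
    by_cases hmn : m + n = 0
    · obtain ⟨rfl, rfl⟩ : m = 0 ∧ n = 0 := by omega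
      simp [Vir.central]
    · rw [if_neg hmn]
      refine ⟨?_, rfl⟩
      rcases le_total 0 (m + n) with h | h
      · rw [virOp_vac h, correction_of_ne hmn, zero_smul, map_zero, mul_zero]
      · rw [functional_virOp hℓ h, correction_of_ne hmn, zero_mul, mul_zero]
  rcases lt_trichotomy m 0 with hm | rfl | hm
  · rcases le_or_gt n 0 with hn | hn
    · obtain ⟨e1, e2⟩ := hsame (Or.inr ⟨hm.le, hn⟩)
      rw [defect_apply, map_sub, map_sub, map_smul, smul_eq_mul, e1, e2,
        functional_virOp hℓ hm.le, functional_virOp hℓ hn, functional_virOp hℓ hn,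
        functional_virOp hℓ hm.le]
      ring
    · have hneg : defect F Z m n (vac F Z) = - defect F Z n m (vac F Z) := by
        rw [defect_apply, defect_apply, add_comm n m]
        push_cast
        module
      rw [hneg, map_neg, functional_defect_of_pos h2 h1 hℓ hn hm, add_comm n m]
      split_ifs with h
      · obtain rfl : n = -m := by omega
        rw [Vir.central_neg]
        ring
      · simp
  · rcases le_total n 0 with hn | hn
    · obtain ⟨e1, e2⟩ := hsame (Or.inr ⟨le_rfl, hn⟩)
      rw [defect_apply, map_sub, map_sub, map_smul, smul_eq_mul, e1, e2,
        functional_virOp hℓ le_rfl, functional_virOp hℓ hn, functional_virOp hℓ hn,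
        functional_virOp hℓ le_rfl]
      ring
    · obtain ⟨e1, e2⟩ := hsame (Or.inl ⟨le_rfl, hn⟩)
      rw [defect_apply, map_sub, map_sub, map_smul, smul_eq_mul, e1, e2]
      simp only [virOp_vac hn, virOp_vac (le_refl (0 : ℤ)), map_smul, smul_eq_mul]
      ring
  · rcases le_or_gt 0 n with hn | hn
    · obtain ⟨e1, e2⟩ := hsame (Or.inl ⟨hm.le, hn⟩)
      rw [defect_apply, map_sub, map_sub, map_smul, smul_eq_mul, e1, e2]
      simp only [virOp_vac hn, virOp_vac hm.le, map_smul, smul_eq_mul]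
      ring
    · exact functional_defect_of_pos h2 h1 hℓ hm hn

/-- The defect commutes with all modes, so its value on the vacuum is killed by annihilation
operators; being even, that value is a multiple of the vacuum. The same scalar then acts everywhere,
since the vacuum generates, and `ℓ` computes it. -/
theorem defect_eq (h2 : (2 : F) ≠ 0) (m n : ℤ) : defect F Z m n =
    ((if m + n = 0 then Vir.central F m else 0) * (1 / 2)) • 1 := by
  obtain ⟨ℓ, h1, hℓ⟩ := exists_vacuum_functional (F := F) (Z := Z) h2
  have hann : ∀ k, 0 < 2 * k + Z.shift → mode F Z k (defect F Z m n (vac F Z)) = 0 := by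
    intro k hk
    rw [← defect_mode h2, mode_vac hk, map_zero]
  obtain ⟨α, β, hαβ⟩ := mem_span_of_annihilated h2 hann
  have hpart : defect F Z m n (vac F Z) ∈ part F Z 0 := by
    have := vac_mem_part (F := F) (Z := Z)
    exact sub_mem (sub_mem (virOp_mem_part F Z m 0 (virOp_mem_part F Z n 0 this))
      (virOp_mem_part F Z n 0 (virOp_mem_part F Z m 0 this)))
      (Submodule.smul_mem _ _ (virOp_mem_part F Z _ 0 this))
  have hβ : β • mode F Z 0 (vac F Z) = 0 := by
    refine part_disjoint h2 (s := 0) ?_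
      (Submodule.smul_mem _ β (fermion_mem_part F Z 0 0 vac_mem_part))
    rw [← sub_eq_iff_eq_add'.2 hαβ]
    exact sub_mem hpart (Submodule.smul_mem _ α vac_mem_part)
  rw [hβ, add_zero] at hαβ
  have hvalue := functional_defect h2 h1 hℓ m n
  have hα : α = (if m + n = 0 then Vir.central F m else 0) * (1 / 2) := by
    rw [← hvalue, hαβ, map_smul, h1, smul_eq_mul, mul_one]
  refine LinearMap.ext fun v => ?_
  rw [LinearMap.smul_apply, Module.End.one_apply, ← hα]
  induction v using fock_induction with
  | hvac => exact hαβ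
  | hadd v w hv hw => rw [map_add, hv, hw, smul_add]
  | hsmul t v hv => rw [map_smul, hv, smul_comm]
  | hmode k v hv =>
    change defect F Z m n (mode F Z k v) = α • mode F Z k v
    rw [defect_mode h2, hv, map_smul]

theorem vir_induction {P : Vir F → Prop} (hL : ∀ n, P (Vir.L F n)) (hC : P (Vir.C F))
    (hadd : ∀ x y, P x → P y → P (x + y)) (hsmul : ∀ (t : F) x, P x → P (t • x)) (x : Vir F) :
    P x := by
  have hzero : P 0 := by simpa using hsmul 0 _ hC
  have key : ∀ f : ℤ →₀ F, P ((Vir.coords F).symm (f, 0)) := by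
    intro f
    induction f using Finsupp.induction_linear with
    | zero => exact hzero
    | add f g hf hg => simpa [← map_add] using hadd _ _ hf hg
    | single n t => simpa [Vir.L, ← map_smul] using hsmul t _ (hL n)
  have h := hadd _ _ (key (Vir.coords F x).1) (hsmul (Vir.coords F x).2 _ hC)
  rwa [Vir.C, ← map_smul, ← map_add, Prod.smul_mk, Prod.mk_add_mk, smul_zero, add_zero, zero_add,
    smul_eq_mul, mul_one, Prod.mk.eta, LinearEquiv.symm_apply_apply] at h

theorem isVirModule_action (h2 : (2 : F) ≠ 0) : IsVirModule (action F Z) := by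
  intro x y
  induction x using vir_induction with
  | hL m =>
    induction y using vir_induction with
    | hL n =>
      have h := defect_eq (F := F) (Z := Z) h2 m n
      rw [defect, sub_eq_iff_eq_add] at h
      rw [Vir.lie_L_L, map_add, map_smul, map_smul, action_L, action_L, action_L, action_C, h,
        smul_smul, add_comm]
    | hC => rw [Vir.lie_C, map_zero, action_C, mul_smul_comm, smul_mul_assoc, mul_one, one_mul,
        sub_self]
    | hadd y z hy hz => rw [lie_add, map_add, map_add, hy, hz, mul_add, add_mul]; abel
    | hsmul t y hy =>
      rw [lie_smul, map_smul, map_smul, hy, mul_smul_comm, smul_mul_assoc, smul_sub]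
  | hC =>
    rw [← lie_skew, Vir.lie_C, neg_zero, map_zero, action_C, mul_smul_comm, smul_mul_assoc, mul_one,
      one_mul, sub_self]
  | hadd x z hx hz => rw [add_lie, map_add, map_add, hx, hz, mul_add, add_mul]; abel
  | hsmul t x hx =>
    rw [smul_lie, map_smul, map_smul, hx, mul_smul_comm, smul_mul_assoc, smul_sub]

theorem partAction_apply (s : ZMod 2) (x : Vir F) (v : part F Z s) :
    (partAction F Z s x v : Fock F Z) = action F Z x v := rfl

theorem isVirModule_partAction (h2 : (2 : F) ≠ 0) (s : ZMod 2) :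
    IsVirModule (partAction F Z s) := by
  intro x y
  refine LinearMap.ext fun v => Subtype.ext ?_
  rw [partAction_apply, isVirModule_action h2]
  rfl

/-- The parity parts are irreducible for the Virasoro algebra. -/
theorem part_irreducible (h2 : (2 : F) ≠ 0) (h7 : (7 : F) ≠ 0) (s : ZMod 2)
    {N : Submodule F (part F Z s)}
    (hN : ∀ n, ∀ v ∈ N, partAction F Z s (Vir.L F n) v ∈ N) (hne : N ≠ ⊥) : N = ⊤ := by
  have hmap : N.map (part F Z s).subtype = part F Z s := by
    refine eq_part_of_stable h2 (fun r t v hv => mode_mode_mem h2 h7 ?_ hv r t)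
      (Submodule.map_subtype_le _ _) ?_
    · rintro n _ ⟨v, hv, rfl⟩
      refine ⟨_, hN n v hv, ?_⟩
      rw [Submodule.subtype_apply, partAction_apply, action_L]
      rfl
    · rw [← Submodule.map_bot (part F Z s).subtype]
      exact (Submodule.map_injective_of_injective (Submodule.injective_subtype _)).ne hne
  rw [eq_top_iff]
  intro v _
  have hv : (v : Fock F Z) ∈ N.map (part F Z s).subtype := by rw [hmap]; exact v.2
  obtain ⟨w, hw, hwv⟩ := hv
  rwa [← Subtype.ext (a1 := w) (a2 := v) hwv]

end Fock

end FockVirasoro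

/-! ### Recognition of the irreducible highest weight modules -/

section VermaModule

namespace Verma

variable {F : Type*} [Field F] {c h : F}

/-- The quotient map from the universal enveloping algebra to the Verma module. -/
def toVerma (F : Type*) [Field F] (c h : F) : UniversalEnvelopingAlgebra F (Vir F)
    →ₗ[UniversalEnvelopingAlgebra F (Vir F)] Verma F c h := (vermaIdeal F c h).mkQ

theorem toVerma_one : toVerma F c h 1 = hwv F c h := rfl

theorem toVerma_surjective : Function.Surjective (toVerma F c h) := Submodule.mkQ_surjective _

theorem lie_toVerma (x : Vir F) (u : UniversalEnvelopingAlgebra F (Vir F)) :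
    ⁅x, toVerma F c h u⁆ = toVerma F c h (envι F x * u) := rfl

theorem toVerma_eq_zero {u : UniversalEnvelopingAlgebra F (Vir F)} (hu : u ∈ vermaIdeal F c h) :
    toVerma F c h u = 0 := (Submodule.Quotient.mk_eq_zero _).2 hu

theorem lie_L_hwv {n : ℤ} (hn : 0 < n) : ⁅Vir.L F n, hwv F c h⁆ = 0 := by
  rw [← toVerma_one, lie_toVerma, mul_one]
  exact toVerma_eq_zero (Submodule.subset_span (Or.inl ⟨n, hn, rfl⟩))

theorem toVerma_algebraMap (t : F) : toVerma F c h (algebraMap F _ t) = t • hwv F c h := by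
  rw [← toVerma_one, Algebra.algebraMap_eq_smul_one]
  rfl

theorem lie_L_zero_hwv : ⁅Vir.L F 0, hwv F c h⁆ = h • hwv F c h := by
  rw [← toVerma_algebraMap, ← toVerma_one, lie_toVerma, mul_one, ← sub_eq_zero, ← map_sub]
  exact toVerma_eq_zero (Submodule.subset_span (Or.inr (Or.inl rfl)))

theorem lie_C_hwv : ⁅Vir.C F, hwv F c h⁆ = c • hwv F c h := by
  rw [← toVerma_algebraMap, ← toVerma_one, lie_toVerma, mul_one, ← sub_eq_zero, ← map_sub]
  exact toVerma_eq_zero (Submodule.subset_span (Or.inr (Or.inr rfl)))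

/-- The Verma module is generated by its highest weight vector. -/
theorem mem_of_hwv_mem {S : Submodule F (Verma F c h)} (h0 : hwv F c h ∈ S)
    (hS : ∀ x : Vir F, ∀ v ∈ S, ⁅x, v⁆ ∈ S) (v : Verma F c h) : v ∈ S := by
  have key : ∀ (t : TensorAlgebra F (Vir F)), ∀ w ∈ S,
      UniversalEnvelopingAlgebra.mkAlgHom F (Vir F) t • w ∈ S := by
    intro t
    induction t using TensorAlgebra.induction with
    | algebraMap r => intro w hw; rw [AlgHom.commutes, algebraMap_smul]; exact S.smul_mem r hw
    | ι x => intro w hw; exact hS x w hw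
    | mul x y hx hy => intro w hw; rw [map_mul, mul_smul]; exact hx _ (hy _ hw)
    | add x y hx hy => intro w hw; rw [map_add, add_smul]; exact add_mem (hx _ hw) (hy _ hw)
  obtain ⟨u, rfl⟩ := toVerma_surjective v
  obtain ⟨t, rfl⟩ : ∃ t, UniversalEnvelopingAlgebra.mkAlgHom F (Vir F) t = u :=
    RingCon.mkₐ_surjective _ u
  have := key t _ h0
  rwa [← toVerma_one, ← map_smul, smul_eq_mul, mul_one] at this

/-! ### The degree decomposition of the Verma module -/

/-- The graded parts of the Verma module, indexed by the integers. -/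
def intDegreePart (F : Type*) [Field F] (c h : F) (d : ℤ) : Submodule F (Verma F c h) :=
  Submodule.span F (monomial F c h '' {l : List ℕ | (∀ i ∈ l, 1 ≤ i) ∧ (l.sum : ℤ) = d})

theorem degreePart_eq (n : ℕ) : degreePart F c h n = intDegreePart F c h n := by
  simp only [degreePart, intDegreePart, Nat.cast_inj]

theorem monomial_cons (n : ℕ) (l : List ℕ) :
    monomial F c h (n :: l) = ⁅Vir.L F (-(n : ℤ)), monomial F c h l⁆ := rfl

theorem monomial_mem {l : List ℕ} (hl : ∀ i ∈ l, 1 ≤ i) {d : ℤ} (hd : (l.sum : ℤ) = d) :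
    monomial F c h l ∈ intDegreePart F c h d := Submodule.subset_span ⟨l, ⟨hl, hd⟩, rfl⟩

theorem lie_C_eq (v : Verma F c h) : ⁅Vir.C F, v⁆ = c • v := by
  let S : Submodule F (Verma F c h) :=
    { carrier := {v | ⁅Vir.C F, v⁆ = c • v}
      add_mem' := fun {v w} hv hw => by
        change ⁅Vir.C F, v + w⁆ = c • (v + w)
        rw [lie_add, show ⁅Vir.C F, v⁆ = c • v from hv, show ⁅Vir.C F, w⁆ = c • w from hw, smul_add]
      zero_mem' := by
        change ⁅Vir.C F, (0 : Verma F c h)⁆ = c • 0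
        rw [lie_zero, smul_zero]
      smul_mem' := fun t v hv => by
        change ⁅Vir.C F, t • v⁆ = c • t • v
        rw [lie_smul, show ⁅Vir.C F, v⁆ = c • v from hv, smul_comm] }
  refine mem_of_hwv_mem (S := S) lie_C_hwv (fun x v hv => ?_) v
  change ⁅Vir.C F, ⁅x, v⁆⁆ = c • ⁅x, v⁆
  rw [leibniz_lie, ← lie_skew, Vir.lie_C, neg_zero, zero_lie, zero_add,
    show ⁅Vir.C F, v⁆ = c • v from hv, lie_smul]

theorem lie_L_neg_mem {n : ℕ} (hn : 1 ≤ n) {d : ℤ} {v : Verma F c h}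
    (hv : v ∈ intDegreePart F c h d) : ⁅Vir.L F (-(n : ℤ)), v⁆ ∈ intDegreePart F c h (d + n) := by
  induction hv using Submodule.span_induction with
  | mem v hv =>
    obtain ⟨l, ⟨hl, hd⟩, rfl⟩ := hv
    rw [← monomial_cons]
    refine monomial_mem (List.forall_mem_cons.2 ⟨hn, hl⟩) ?_
    rw [List.sum_cons, Nat.cast_add]
    omega
  | zero => rw [lie_zero]; exact zero_mem _
  | add v w _ _ hv hw => rw [lie_add]; exact add_mem hv hw
  | smul t v _ hv => rw [lie_smul]; exact Submodule.smul_mem _ t hv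

theorem lie_L_monomial_mem (l : List ℕ) (hl : ∀ i ∈ l, 1 ≤ i) (m : ℤ) :
    ⁅Vir.L F m, monomial F c h l⁆ ∈ intDegreePart F c h (l.sum - m) := by
  induction l generalizing m with
  | nil =>
    rcases lt_trichotomy m 0 with hm | rfl | hm
    · obtain ⟨n, rfl⟩ : ∃ n : ℕ, m = -(n : ℤ) := ⟨m.natAbs, by omega⟩
      rw [← monomial_cons]
      exact monomial_mem (by simp; omega) (by simp)
    · change ⁅Vir.L F 0, hwv F c h⁆ ∈ _
      rw [lie_L_zero_hwv]
      exact Submodule.smul_mem _ _ (monomial_mem (l := []) (by simp) (by simp))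
    · change ⁅Vir.L F m, hwv F c h⁆ ∈ _
      rw [lie_L_hwv hm]
      exact zero_mem _
  | cons n l ih =>
    have hl' := List.forall_mem_cons.1 hl
    rw [monomial_cons, leibniz_lie, Vir.lie_L_L, add_lie, smul_lie, smul_lie, lie_C_eq,
      List.sum_cons]
    refine add_mem (add_mem (Submodule.smul_mem _ _ ?_) ?_) ?_
    · have := ih hl'.2 (m + -(n : ℤ))
      convert this using 2
      rw [Nat.cast_add]
      ring
    · split_ifs with hmn
      · refine Submodule.smul_mem _ _ (Submodule.smul_mem _ _ (monomial_mem hl'.2 ?_))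
        rw [Nat.cast_add]
        omega
      · rw [zero_smul]
        exact zero_mem _
    · have := lie_L_neg_mem hl'.1 (ih hl'.2 m)
      convert this using 2
      rw [Nat.cast_add]
      ring

theorem lie_L_mem (m : ℤ) {d : ℤ} {v : Verma F c h} (hv : v ∈ intDegreePart F c h d) :
    ⁅Vir.L F m, v⁆ ∈ intDegreePart F c h (d - m) := by
  induction hv using Submodule.span_induction with
  | mem v hv =>
    obtain ⟨l, ⟨hl, rfl⟩, rfl⟩ := hv
    exact lie_L_monomial_mem l hl m
  | zero => rw [lie_zero]; exact zero_mem _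
  | add v w _ _ hv hw => rw [lie_add]; exact add_mem hv hw
  | smul t v _ hv => rw [lie_smul]; exact Submodule.smul_mem _ t hv

theorem mem_iSup_degreePart (v : Verma F c h) : v ∈ ⨆ n : ℕ, degreePart F c h n := by
  refine mem_of_hwv_mem ?_ ?_ v
  · exact Submodule.mem_iSup_of_mem 0 (Submodule.subset_span ⟨[], by simp, rfl⟩)
  · intro x v hv
    have hle : ∀ d : ℤ, intDegreePart F c h d ≤ ⨆ n : ℕ, degreePart F c h n := by
      intro d
      refine Submodule.span_le.2 ?_
      rintro _ ⟨l, ⟨hl, -⟩, rfl⟩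
      exact Submodule.mem_iSup_of_mem l.sum (Submodule.subset_span ⟨l, ⟨hl, rfl⟩, rfl⟩)
    induction x using Fock.vir_induction with
    | hL m =>
      induction hv using Submodule.iSup_induction' with
      | mem n v hv => rw [degreePart_eq] at hv; exact hle _ (lie_L_mem m hv)
      | zero => rw [lie_zero]; exact zero_mem _
      | add v w _ _ hv hw => rw [lie_add]; exact add_mem hv hw
    | hC => rw [lie_C_eq]; exact Submodule.smul_mem _ c hv
    | hadd x y hx hy => rw [add_lie]; exact add_mem hx hy
    | hsmul t x hx => rw [smul_lie]; exact Submodule.smul_mem _ t hx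

theorem degreePart_zero : degreePart F c h 0 = Submodule.span F {hwv F c h} := by
  rw [degreePart]
  congr 1
  ext v
  constructor
  · rintro ⟨l, ⟨hl, hs⟩, rfl⟩
    cases l with
    | nil => rfl
    | cons n l =>
      have := (List.forall_mem_cons.1 hl).1
      rw [List.sum_cons] at hs
      omega
  · rintro rfl
    exact ⟨[], by simp, rfl⟩

/-! ### Maps out of the Verma module and its maximal graded submodule -/

section Lift

attribute [local instance] LieRing.ofAssociativeRing

variable {M : Type*} [AddCommGroup M] [Module F M]

/-- The homomorphism from the Verma module to a module with a highest weight vector. -/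
theorem exists_hom {ρ : Vir F →ₗ[F] Module.End F M} (hρ : IsVirModule ρ) {w : M}
    (hpos : ∀ n : ℤ, 0 < n → ρ (Vir.L F n) w = 0) (h0 : ρ (Vir.L F 0) w = h • w)
    (hC : ρ (Vir.C F) w = c • w) :
    ∃ π : Verma F c h →ₗ[F] M, π (hwv F c h) = w ∧ ∀ x v, π ⁅x, v⁆ = ρ x (π v) := by
  let f : Vir F →ₗ⁅F⁆ Module.End F M :=
    { ρ with
      map_lie' := fun {x y} => by
        rw [LieRing.of_associative_ring_bracket]
        exact hρ x y }
  let φ := UniversalEnvelopingAlgebra.lift F f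
  have hφ : ∀ x, φ (envι F x) = ρ x := fun x => UniversalEnvelopingAlgebra.lift_ι_apply F f x
  let g : UniversalEnvelopingAlgebra F (Vir F) →ₗ[F] M := LinearMap.applyₗ w ∘ₗ φ.toLinearMap
  have hg : ∀ u, g u = φ u w := fun u => rfl
  have hker : (vermaIdeal F c h).restrictScalars F ≤ LinearMap.ker g := by
    intro u hu
    rw [Submodule.restrictScalars_mem] at hu
    rw [LinearMap.mem_ker, hg]
    induction hu using Submodule.span_induction with
    | mem u hu =>
      rcases hu with ⟨n, hn, rfl⟩ | rfl | rfl
      · rw [hφ, hpos n hn]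
      · rw [map_sub, hφ, AlgHom.commutes, LinearMap.sub_apply, h0, Module.algebraMap_end_apply,
          sub_self]
      · rw [map_sub, hφ, AlgHom.commutes, LinearMap.sub_apply, hC, Module.algebraMap_end_apply,
          sub_self]
    | zero => rw [map_zero, LinearMap.zero_apply]
    | add u v _ _ hu hv => rw [map_add, LinearMap.add_apply, hu, hv, add_zero]
    | smul t u _ hu => rw [smul_eq_mul, map_mul, Module.End.mul_apply, hu, map_zero]
  let π : Verma F c h →ₗ[F] M := (Submodule.liftQ _ g hker) ∘ₗ
    (Submodule.Quotient.restrictScalarsEquiv F (vermaIdeal F c h)).symm.toLinearMap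
  have hπ : ∀ u, π (toVerma F c h u) = φ u w := fun u => rfl
  refine ⟨π, ?_, fun x v => ?_⟩
  · rw [← toVerma_one, hπ, map_one, Module.End.one_apply]
  · obtain ⟨u, rfl⟩ := toVerma_surjective v
    rw [lie_toVerma, hπ, hπ, map_mul, hφ, Module.End.mul_apply]

/-- A nonempty monomial begins with some `L_{-n}`, whose image `ℓ` kills; so `ℓ ∘ π` detects degree
zero alone. This takes over the role of `L_0`-eigenvalues, and of the independence of the degree
parts. -/
theorem functional_eq_zero {ρ : Vir F →ₗ[F] Module.End F M} {π : Verma F c h →ₗ[F] M}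
    (hπ : ∀ x v, π ⁅x, v⁆ = ρ x (π v)) {ℓ : M →ₗ[F] F}
    (hℓ : ∀ n : ℕ, 1 ≤ n → ∀ x, ℓ (ρ (Vir.L F (-(n : ℤ))) x) = 0) {d : ℤ} (hd : d ≠ 0)
    {v : Verma F c h} (hv : v ∈ intDegreePart F c h d) : ℓ (π v) = 0 := by
  have hle : intDegreePart F c h d ≤ LinearMap.ker (ℓ ∘ₗ π) := by
    refine Submodule.span_le.2 ?_
    rintro _ ⟨l, ⟨hl, hs⟩, rfl⟩
    cases l with
    | nil => exact absurd hs.symm (by simpa using hd)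
    | cons n l =>
      change ℓ (π (monomial F c h (n :: l))) = 0
      rw [monomial_cons, hπ, hℓ n (List.forall_mem_cons.1 hl).1]
  exact hle hv

/-- Successive application of the operators `L_n`. -/
def lieList (l : List ℤ) (v : Verma F c h) : Verma F c h := l.foldr (fun n v => ⁅Vir.L F n, v⁆) v

theorem lieList_mem (l : List ℤ) {d : ℤ} {v : Verma F c h} (hv : v ∈ intDegreePart F c h d) :
    lieList l v ∈ intDegreePart F c h (d - l.sum) := by
  induction l with
  | nil => simpa [lieList] using hv
  | cons n l ih =>
    have := lie_L_mem n ih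
    rw [List.sum_cons, show d - (n + l.sum) = d - l.sum - n by ring]
    exact this

theorem map_lieList {ρ : Vir F →ₗ[F] Module.End F M} {π : Verma F c h →ₗ[F] M}
    (hπ : ∀ x v, π ⁅x, v⁆ = ρ x (π v)) (l : List ℤ) (v : Verma F c h) :
    π (lieList l v) = (l.map fun n => ρ (Vir.L F n)).prod (π v) := by
  induction l with
  | nil => simp [lieList]
  | cons n l ih =>
    change π ⁅Vir.L F n, lieList l v⁆ = _
    rw [hπ, ih, List.map_cons, List.prod_cons, Module.End.mul_apply]

/-- The image of a vector vanishes if all its matrix coefficients vanish. -/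
theorem map_eq_zero_of_forall {ρ : Vir F →ₗ[F] Module.End F M} {π : Verma F c h →ₗ[F] M}
    (hπ : ∀ x v, π ⁅x, v⁆ = ρ x (π v)) {ℓ : M →ₗ[F] F} (hℓ : ℓ ≠ 0)
    (hirr : ∀ N : Submodule F M, (∀ n, ∀ v ∈ N, ρ (Vir.L F n) v ∈ N) → N ≠ ⊥ → N = ⊤)
    {v : Verma F c h} (hv : ∀ l, ℓ (π (lieList l v)) = 0) : π v = 0 := by
  -- The common kernel of all matrix coefficients is stable under every `L_n` and is not everything
  -- because `ℓ ≠ 0`; irreducibility makes it zero.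
  let J : Submodule F M :=
    ⨅ l : List ℤ, LinearMap.ker (ℓ ∘ₗ (l.map fun n => ρ (Vir.L F n)).prod)
  have hJ : ∀ x, x ∈ J ↔ ∀ l : List ℤ, ℓ ((l.map fun n => ρ (Vir.L F n)).prod x) = 0 := by
    intro x
    simp [J, Submodule.mem_iInf]
  have hbot : J = ⊥ := by
    by_contra hne
    have htop := hirr J (fun n x hx => (hJ _).2 fun l => by
      have := (hJ x).1 hx (l ++ [n])
      simpa using this) hne
    refine hℓ (LinearMap.ext fun x => ?_)
    have hx : x ∈ J := htop ▸ Submodule.mem_top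
    simpa using (hJ x).1 hx []
  have : π v ∈ J := (hJ _).2 fun l => by rw [← map_lieList hπ, hv]
  rwa [hbot, Submodule.mem_bot] at this

theorem maxGraded_eq_ker {ρ : Vir F →ₗ[F] Module.End F M} {w : M}
    {π : Verma F c h →ₗ[F] M} (hw : π (hwv F c h) = w) (hπ : ∀ x v, π ⁅x, v⁆ = ρ x (π v))
    {ℓ : M →ₗ[F] F} (hℓw : ℓ w = 1)
    (hℓ : ∀ n : ℕ, 1 ≤ n → ∀ x, ℓ (ρ (Vir.L F (-(n : ℤ))) x) = 0)
    (hirr : ∀ N : Submodule F M, (∀ n, ∀ v ∈ N, ρ (Vir.L F n) v ∈ N) → N ≠ ⊥ → N = ⊤) :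
    (maxGraded F c h).toSubmodule = LinearMap.ker π := by
  have hℓ0 : ℓ ≠ 0 := by
    rintro rfl
    simp at hℓw
  let K : LieSubmodule F (Vir F) (Verma F c h) :=
    { LinearMap.ker π with
      lie_mem := fun {x v} hv => by
        have hv' : π v = 0 := hv
        change π ⁅x, v⁆ = 0
        rw [hπ, hv', map_zero] }
  have hK : ∀ v, v ∈ K ↔ π v = 0 := fun v => Iff.rfl
  have hgraded : IsGraded F c h K := by
    refine le_antisymm (fun v hv => ?_) (iSup_le fun n => inf_le_left)
    have hv' : π v = 0 := hv
    obtain ⟨f, hf, rfl⟩ := (Submodule.mem_iSup_iff_exists_finsupp _ v).1 (mem_iSup_degreePart v)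
    refine sum_mem fun i _ => Submodule.mem_iSup_of_mem i ⟨?_, hf i⟩
    change π (f i) = 0
    refine map_eq_zero_of_forall hπ hℓ0 hirr fun l => ?_
    -- A word in the `L_n` lowers the degree by the sum of its indices, so each matrix coefficient
    -- sees one component only, and that one then equals the coefficient of the whole vector, which
    -- is zero.
    have hne : ∀ j : ℕ, (j : ℤ) ≠ l.sum → ℓ (π (lieList l (f j))) = 0 := fun j hj =>
      functional_eq_zero hπ hℓ (sub_ne_zero.2 hj) (lieList_mem l (degreePart_eq (F := F) j ▸ hf j))
    by_cases hi : (i : ℤ) = l.sum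
    · by_cases hmem : i ∈ f.support
      · have hsum : ℓ ((l.map fun n => ρ (Vir.L F n)).prod (π (f.sum fun _ x => x))) = 0 := by
          rw [hv', map_zero, map_zero]
        rw [Finsupp.sum, map_sum, map_sum, map_sum, Finset.sum_eq_single_of_mem i hmem] at hsum
        · rwa [map_lieList hπ]
        · intro j _ hji
          rw [← map_lieList hπ]
          exact hne j (by omega)
      · rw [Finsupp.notMem_support_iff.1 hmem, map_lieList hπ, map_zero, map_zero, map_zero]
    · exact hne i hi
  have hproper : K ≠ ⊤ := by
    intro htop
    have : hwv F c h ∈ K := htop ▸ LieSubmodule.mem_top _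
    rw [hK, hw] at this
    rw [this, map_zero] at hℓw
    exact zero_ne_one hℓw
  have hmax : maxGraded F c h = K := by
    refine le_antisymm (sSup_le ?_) (le_sSup ⟨hgraded, hproper⟩)
    rintro N ⟨hN, hNtop⟩
    by_contra hNK
    -- A graded submodule not inside the kernel maps onto the irreducible module, hence hits `w`;
    -- its degree zero component is then a nonzero multiple of the highest weight vector, so the
    -- submodule is everything.
    have htop : N.toSubmodule.map π = ⊤ := by
      refine hirr _ ?_ ?_
      · rintro n _ ⟨v, hv, rfl⟩
        exact ⟨⁅Vir.L F n, v⁆, N.lie_mem hv, hπ _ _⟩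
      · intro hbot
        refine hNK fun v hv => ?_
        have : π v ∈ N.toSubmodule.map π := ⟨v, hv, rfl⟩
        rwa [hbot, Submodule.mem_bot] at this
    obtain ⟨v, hv, hvw⟩ : w ∈ N.toSubmodule.map π := htop ▸ Submodule.mem_top
    have hv' : v ∈ ⨆ n : ℕ, N.toSubmodule ⊓ degreePart F c h n := by
      rw [← hN]
      exact hv
    obtain ⟨f, hf, rfl⟩ := (Submodule.mem_iSup_iff_exists_finsupp _ v).1 hv'
    have hzero : ℓ (π (f 0)) = 1 := by
      rw [← hℓw, ← hvw, Finsupp.sum, map_sum, map_sum]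
      by_cases hmem : 0 ∈ f.support
      · rw [Finset.sum_eq_single_of_mem 0 hmem]
        intro j _ hj
        exact functional_eq_zero hπ hℓ (by exact_mod_cast hj) (degreePart_eq (F := F) j ▸ (hf j).2)
      · rw [Finsupp.notMem_support_iff.1 hmem, map_zero, map_zero, Finset.sum_eq_zero]
        intro j hj
        have hj0 : j ≠ 0 := fun h => hmem (h ▸ hj)
        exact functional_eq_zero hπ hℓ (by exact_mod_cast hj0)
          (degreePart_eq (F := F) j ▸ (hf j).2)
    obtain ⟨t, ht⟩ : ∃ t : F, t • hwv F c h = f 0 :=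
      Submodule.mem_span_singleton.1 (degreePart_zero (F := F) (c := c) (h := h) ▸ (hf 0).2)
    have ht0 : t ≠ 0 := by
      rintro rfl
      rw [← ht, zero_smul, map_zero, map_zero] at hzero
      exact zero_ne_one hzero
    have hhwv : hwv F c h ∈ N.toSubmodule := by
      have := N.toSubmodule.smul_mem t⁻¹ (hf 0).1
      rwa [← ht, smul_smul, inv_mul_cancel₀ ht0, one_smul] at this
    refine hNtop (eq_top_iff.2 fun v _ => ?_)
    exact mem_of_hwv_mem (S := N.toSubmodule) hhwv (fun x v hv => N.lie_mem hv) v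
  rw [hmax]

/-- An irreducible module with a highest weight vector and a functional that detects this vector is
isomorphic to the irreducible highest weight module. -/
theorem virIsomorphic_irredHW {ρ : Vir F →ₗ[F] Module.End F M} (hρ : IsVirModule ρ) {w : M}
    (hpos : ∀ n : ℤ, 0 < n → ρ (Vir.L F n) w = 0) (h0 : ρ (Vir.L F 0) w = h • w)
    (hC : ρ (Vir.C F) w = c • w) {ℓ : M →ₗ[F] F} (hℓw : ℓ w = 1)
    (hℓ : ∀ n : ℕ, 1 ≤ n → ∀ x, ℓ (ρ (Vir.L F (-(n : ℤ))) x) = 0)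
    (hirr : ∀ N : Submodule F M, (∀ n, ∀ v ∈ N, ρ (Vir.L F n) v ∈ N) → N ≠ ⊥ → N = ⊤) :
    VirIsomorphic ρ (IrredHW F c h) := by
  refine ⟨hρ, ?_⟩
  obtain ⟨π, hw, hπ⟩ := exists_hom (c := c) (h := h) hρ hpos h0 hC
  have hker := maxGraded_eq_ker hw hπ hℓw hℓ hirr
  have hsurj : Function.Surjective π := by
    rw [← LinearMap.range_eq_top]
    refine hirr _ ?_ ?_
    · rintro n _ ⟨v, rfl⟩
      exact ⟨⁅Vir.L F n, v⁆, hπ _ _⟩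
    · intro hbot
      have : w ∈ LinearMap.range π := ⟨_, hw⟩
      rw [hbot, Submodule.mem_bot] at this
      rw [this, map_zero] at hℓw
      exact zero_ne_one hℓw
  let e : IrredHW F c h ≃ₗ[F] M :=
    (Submodule.quotEquivOfEq _ _ hker).trans (π.quotKerEquivOfSurjective hsurj)
  have he : ∀ v : Verma F c h,
      e (LieSubmodule.Quotient.mk' (maxGraded F c h) v) = π v := fun v => rfl
  refine ⟨e.symm, fun x m => ?_⟩
  rw [LinearEquiv.symm_apply_eq]
  obtain ⟨q, rfl⟩ := e.surjective m
  rw [e.symm_apply_apply]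
  obtain ⟨v, rfl⟩ := LieSubmodule.Quotient.surjective_mk' (maxGraded F c h) q
  rw [← LieModuleHom.map_lie, he, he, hπ]

end Lift

end Verma

end VermaModule

/-! ### The parity parts as irreducible highest weight modules -/

section FockIrreducible

namespace Fock

variable {F : Type*} [Field F] {Z : Sector}

theorem virIsomorphic_part_zero (h2 : (2 : F) ≠ 0) (h7 : (7 : F) ≠ 0) :
    VirIsomorphic (partAction F Z 0) (IrredHW F (1 / 2) (correction F Z 0)) := by
  obtain ⟨ℓ, h1, hℓ⟩ := exists_vacuum_functional (F := F) (Z := Z) h2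
  refine Verma.virIsomorphic_irredHW (isVirModule_partAction h2 0) (w := ⟨vac F Z, vac_mem_part⟩)
    (fun n hn => Subtype.ext ?_) (Subtype.ext ?_) (Subtype.ext ?_)
    (ℓ := ℓ ∘ₗ (part F Z 0).subtype) h1 (fun n hn x => ?_)
    (fun N hN hne => part_irreducible h2 h7 0 hN hne)
  · rw [partAction_apply, action_L, virOp_vac hn.le, correction_of_ne hn.ne', zero_smul]
    rfl
  · rw [partAction_apply, action_L, virOp_vac le_rfl]
    rfl
  · rw [partAction_apply, action_C]
    rfl
  · rw [LinearMap.comp_apply, Submodule.subtype_apply, partAction_apply, action_L,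
      functional_virOp hℓ (by omega), correction_of_ne (by omega), zero_mul]

/-- The highest weight vector is `a(q) 1` and the functional is `ℓ` after the opposite mode.
Hypothesis `hqn` serves twice through the commutator of `L(±n)` with a mode: it makes `L(n)` kill
the vector and the functional kill the image of `L(-n)`. -/
theorem virIsomorphic_part_one (h2 : (2 : F) ≠ 0) (h7 : (7 : F) ≠ 0) {q : ℤ}
    (hq : 2 * q + Z.shift ≤ 0)
    (hqn : ∀ n : ℤ, 0 < n →
      (q : F) + (Z.shift : F) / 2 + (n : F) / 2 = 0 ∨ 0 < 2 * (n + q) + Z.shift)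
    {h : F} (hh : correction F Z 0 - ((q : F) + (Z.shift : F) / 2) = h) :
    VirIsomorphic (partAction F Z 1) (IrredHW F (1 / 2) h) := by
  obtain ⟨ℓ, h1, hℓ⟩ := exists_vacuum_functional (F := F) (Z := Z) h2
  have hmem : mode F Z q (vac F Z) ∈ part F Z 1 := fermion_mem_part F Z q 0 vac_mem_part
  -- This normalising value is `ℓ` of the opposite mode applied to `a(q) 1`: it is `1`, or `1/2`
  -- when `q` is the zero mode.
  have hθ : modeStep F Z.shift (-q - Z.shift) ≠ 0 := by
    rw [modeStep]
    rcases lt_or_eq_of_le hq with h | h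
    · rw [if_pos (by omega)]
      exact one_ne_zero
    · rw [if_neg (by omega), if_pos (by omega)]
      exact one_div_ne_zero h2
  refine Verma.virIsomorphic_irredHW (isVirModule_partAction h2 1) (w := ⟨_, hmem⟩)
    (fun n hn => Subtype.ext ?_) (Subtype.ext ?_) (Subtype.ext ?_)
    (ℓ := (modeStep F Z.shift (-q - Z.shift))⁻¹ •
      (ℓ ∘ₗ mode F Z (-q - Z.shift) ∘ₗ (part F Z 1).subtype)) ?_ (fun n hn x => ?_)
    (fun N hN hne => part_irreducible h2 h7 1 hN hne)
  · rw [partAction_apply, action_L, virOp_mode h2, virOp_vac hn.le, correction_of_ne hn.ne',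
      zero_smul, map_zero, zero_sub]
    rcases hqn n hn with h0 | h0
    · rw [h0, zero_smul, neg_zero]
      rfl
    · rw [mode_vac h0, smul_zero, neg_zero]
      rfl
  · rw [partAction_apply, action_L, virOp_mode h2, virOp_vac le_rfl, map_smul, zero_add,
      Int.cast_zero, zero_div, add_zero, ← sub_smul, hh]
    rfl
  · rw [partAction_apply, action_C]
    rfl
  · rw [LinearMap.smul_apply, LinearMap.comp_apply, LinearMap.comp_apply, Submodule.subtype_apply,
      functional_mode_mode_vac h2 h1 hℓ, contraction, if_pos (by ring), smul_eq_mul,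
      inv_mul_cancel₀ hθ]
  · have hcomm := virOp_mode h2 (-n) (-q - Z.shift) (x : Fock F Z)
    have hx : mode F Z (-q - Z.shift) (virOp F Z (-n) x) =
        virOp F Z (-n) (mode F Z (-q - Z.shift) x) +
          (((-q - Z.shift : ℤ) : F) + (Z.shift : F) / 2 + ((-n : ℤ) : F) / 2) •
            mode F Z (-n + (-q - Z.shift)) x := by
      rw [hcomm, sub_add_cancel]
    rw [LinearMap.smul_apply, LinearMap.comp_apply, LinearMap.comp_apply, Submodule.subtype_apply,
      partAction_apply, action_L, hx, map_add, functional_virOp hℓ (by omega),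
      correction_of_ne (by omega), zero_mul, zero_add, map_smul]
    rcases hqn n (by omega) with h0 | h0
    · have : ((-q - Z.shift : ℤ) : F) + (Z.shift : F) / 2 + ((-n : ℤ) : F) / 2 = 0 := by
        have hs : (Z.shift : F) / 2 * 2 = Z.shift := div_mul_cancel₀ _ h2
        push_cast at h0 ⊢
        linear_combination hs - h0
      rw [this, zero_smul, smul_zero]
    · rw [hℓ _ (by omega), smul_zero, smul_zero]

end Fock

end FockIrreducible
end

/-! ### The three isomorphisms -/

theorem theorem4p3 (F : Type*) [Field F] (h2 : ringChar F ≠ 2) (h7 : ringChar F ≠ 7) :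
    VirIsomorphic (Fock.partAction F Sector.half 0) (IrredHW F (1 / 2) 0) ∧
      VirIsomorphic (Fock.partAction F Sector.half 1) (IrredHW F (1 / 2) (1 / 2)) ∧
      ∀ s : ZMod 2,
        VirIsomorphic (Fock.partAction F Sector.int s) (IrredHW F (1 / 2) (1 / 16)) := by
  have hprime : ∀ p : ℕ, p.Prime → ringChar F ≠ p → (p : F) ≠ 0 := fun p hp hne h0 =>
    ((Nat.dvd_prime hp).1 ((ringChar.spec F p).1 h0)).elim CharP.ringChar_ne_one hne
  have h2' : (2 : F) ≠ 0 := by exact_mod_cast hprime 2 Nat.prime_two h2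
  have h7' : (7 : F) ≠ 0 := by exact_mod_cast hprime 7 (by norm_num) h7
  refine ⟨Fock.virIsomorphic_part_zero h2' h7', ?_, fun s => ?_⟩
  -- Index `-1` is the mode `-1/2`, so `a(-1/2) 1` has weight `1/2`.
  · refine Fock.virIsomorphic_part_one h2' h7' (q := -1) (by simp [Sector.shift]) ?_ ?_
    · intro n hn
      simp only [Sector.shift]
      rcases (show n = 1 ∨ 2 ≤ n by omega) with rfl | hn
      · left
        push_cast
        field_simp
        ring
      · right
        omega
    · simp only [Fock.correction, Sector.shift]
      push_cast
      field_simp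
      ring
  · have h16 : Fock.correction F Sector.int 0 = 1 / 16 := by simp [Fock.correction]
    rcases (by decide : ∀ s : ZMod 2, s = 0 ∨ s = 1) s with rfl | rfl
    · have := Fock.virIsomorphic_part_zero (F := F) (Z := Sector.int) h2' h7'
      rwa [h16] at this
    -- The zero mode does not change the weight, so the odd part again has highest weight `1/16`.
    · refine Fock.virIsomorphic_part_one h2' h7' (q := 0) (by simp [Sector.shift]) ?_ ?_
      · intro n hn
        right
        simp only [Sector.shift]
        omega
      · simp [Fock.correction, Sector.shift]
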